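/- **Setting.** Let $d\ge 2$. For $N\ge1$ let $\mathbb T=(\mathbb Z/N\mathbb Z)^d$, let $E=\mathbb T\times\mathbb Z$, and let $\pi_E:\mathbb Z^{d+1}\to E$ be the canonical projection; $|\cdot|$ on $E$ denotes the distance induced by the Euclidean distance of $\mathbb Z^{d+1}$. $P_x$ is the law of simple random walk $X=(Y,Z)$ on $E$ (the projection of simple random walk on $\mathbb Z^{d+1}$) started at $x$, and $P_{\nu_z}=N^{-d}\sum_{y\in\mathbb T}P_{(y,z)}$. Write $H_U=\inf\{n\ge0: X_n\in U\}$, $\widetilde H_U=\inf\{n\ge1:X_n\in U\}$, $T_U=\inf\{n\ge0:X_n\notin U\}$. For finite $K\subseteq U\subsetneq E$ put $\mathrm{cap}_U(K)=\sum_{x\in K}P_x[\widetilde H_K>T_U]$, and for finite $K\subset\mathbb Z^{d+1}$ put $\mathrm{cap}(K)=\sum_{x\in K}P^{\mathbb Z^{d+1}}_x[\widetilde H_K=\infty]$. Let $M\ge1$, let $K_1,\dots,K_M\subset\mathbb Z^{d+1}$ be finite, and for each $N$ let $x_1,\dots,x_M\in E$, with $\mathbb Z$-components $z_1,\dots,z_M$,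 be such that $|x_i-x_j|\to\infty$ for $i\ne j$ and $z_i/N^d\to v_i\in\mathbb R$ as $N\to\infty$. Let $w_1<\dots<w_L$ be the distinct values of the $v_i$, and let $\mathcal I_\ell=\{i:v_i=w_\ell\}$. Let $h_N,d_N$ be sequences of non-negative integers tending to infinity such that $h_N=o(N^d)$, $h_N\ge N(\log N)^2$, $d_N=o(h_N)$ and $1+\max_\ell\max_{i,i'\in\mathcal I_\ell}|z_i-z_{i'}|=o(d_N)$. Put $z^*_\ell=\max\{z_i:i\in\mathcal I_\ell\}$, $I_\ell=z^*_\ell+[-d_N,d_N]$, $\widetilde I_\ell=z^*_\ell+(-h_N,h_N)$ (intervals in $\mathbb Z$), $\widetilde B_\ell=\mathbb T\times\widetilde I_\ell$ and $C_\ell=\bigcup_{i\in\mathcal I_\ell}(x_i+K_i)$, where $x_i+K_i$ means $x_i+\pi_E(K_i)\subset E$. Let $$\mathcal G=\{z^*_1,\dots,z^*_L\}\cup\{z\in2h_N\mathbb Z:\ |z-z^*_\ell|\ge2h_N\text{ for all }\ell\},$$ let $R_1$ be the entrance time of $X$ in $\mathbb T\times(\mathcal G+[-d_N,d_N])$, let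 $D_1\ge R_1$ be the first time after $R_1$ at which $X$ is outside $\mathbb T\times(\mathcal G+(-h_N,h_N))$, and set $P_{z,z'}=P_{\nu_z}[\,\cdot\mid Z_{D_1}=z']$. (For large $N$ and $z\in I_\ell$, $D_1$ is $P_{\nu_z}$-almost surely the exit time of $\widetilde B_\ell$, so that $P_{z,z'}$ is the law of the walk started uniformly on the level $\mathbb T\times\{z\}$ and conditioned to exit $\widetilde B_\ell$ at level $z'$.) For $A\subset\mathbb Z$ let $\partial A=\{z\notin A:\exists z'\in A,\ |z-z'|=1\}$ and $\partial_{\rm int}A=\{z\in A:\exists z'\notin A,\ |z-z'|=1\}$. **Lemma 4.2.** There is a constant $c>0$ depending only on $d$ such that in the above setting, for all large $N$, all $1\le\ell\le L$, all $z_1\in\partial_{\rm int}I_\ell$ and all $z_2\in\partial\widetilde I_\ell$, $$P_{z_1,z_2}\big[H_{C_\ell}<T_{\widetilde B_\ell}\big]=(d+1)\,\frac{h_N}{N^d}\,\mathrm{cap}_{\widetilde B_\ell}(C_\ell)\,\big(1+\Psi_\ell(z_1,z_2)\big),\qquad|\Psi_\ell(z_1,z_2)|\le c\,\frac{d_N}{h_N}.$$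 Moreover, for each $1\le\ell\le L$, $$\lim_{N\to\infty}\mathrm{cap}_{\widetilde B_\ell}(C_\ell)=\sum_{i\in\mathcal I_\ell}\mathrm{cap}(K_i).$$ -/

import Mathlib

open MeasureTheory ProbabilityTheory Filter Topology Asymptotics
open scoped ENNReal

namespace CylinderWalk

noncomputable section

/-- The lattice `ℤ^(d+1)`. -/
abbrev ZLat (d : ℕ) : Type := Fin (d + 1) → ℤ

/-- The torus `𝕋 = (ℤ / Nℤ)^d`. -/
abbrev Torus (d N : ℕ) : Type := Fin d → ZMod N

/-- The discrete cylinder `E = 𝕋 × ℤ`. -/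
abbrev Cyl (d N : ℕ) : Type := Torus d N × ℤ

/-- The canonical projection `π_E : ℤ^(d+1) → E`; the last coordinate is the vertical one. -/
def proj (d N : ℕ) (u : ZLat d) : Cyl d N :=
  (fun j => ((u j.castSucc : ℤ) : ZMod N), u (Fin.last d))

/-- The distance on `E` induced by the Euclidean distance on `ℤ^(d+1)`: the least Euclidean length
of a lattice vector that projects onto the difference. -/
def cylDist {d N : ℕ} (x y : Cyl d N) : ℝ :=
  sInf {r : ℝ | ∃ u : ZLat d, proj d N u = x - y ∧ r = √(∑ j, (u j : ℝ) ^ 2)}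

/-! ### Simple random walk -/

/-- The `2 (d + 1)` unit steps `± e_j` of the lattice. -/
def unitStep (d : ℕ) (p : Fin (d + 1) × Bool) : ZLat d :=
  Pi.single p.1 (if p.2 then 1 else -1)

/-- The law, on the space of trajectories `ℕ → G`, of the walk `n ↦ x + s (ω 0) + ⋯ + s (ω (n-1))`,
where the `ω k` are independent and uniformly distributed on the `2 (d + 1)` directions. -/
def walkLaw {d : ℕ} {G : Type*} [AddCommGroup G] [MeasurableSpace G]
    (s : Fin (d + 1) × Bool → G) (x : G) : Measure (ℕ → G) :=
  (Measure.infinitePi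
      (fun _ : ℕ => (PMF.uniformOfFintype (Fin (d + 1) × Bool)).toMeasure)).map
    (fun ω n => x + ∑ k ∈ Finset.range n, s (ω k))

/-- `P_x^{ℤ^(d+1)}`: the law of simple random walk on `ℤ^(d+1)` started at `x`. -/
def latticeLaw (d : ℕ) (x : ZLat d) : Measure (ℕ → ZLat d) :=
  walkLaw (unitStep d) x

/-- `P_x`: the law of simple random walk on the cylinder started at `x`. -/
def cylLaw (d N : ℕ) (x : Cyl d N) : Measure (ℕ → Cyl d N) :=
  walkLaw (fun p => proj d N (unitStep d p)) x

/-- `P_{ν_z}`: the law of simple random walk on the cylinder started with the uniform distribution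
`ν_z` on the level `𝕋 × {z}`, that is `N^{-d} ∑_{y ∈ 𝕋} P_{(y,z)}`. -/
def levelLaw (d N : ℕ) (z : ℤ) : Measure (ℕ → Cyl d N) :=
  ((N : ℝ≥0∞) ^ d)⁻¹ • Measure.sum (fun y : Torus d N => cylLaw d N (y, z))

/-! ### Entrance, hitting and exit times, with values in `ℕ ∪ {∞}` -/

/-- The entrance time `H_U = inf {n ≥ 0 : X_n ∈ U}`. -/
def entranceTime {S : Type*} (U : Set S) (w : ℕ → S) : WithTop ℕ :=
  hittingAfter (fun n (w : ℕ → S) => w n) U 0 w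

/-- The hitting time `inf {n ≥ 1 : X_n ∈ U}`. -/
def hitTime {S : Type*} (U : Set S) (w : ℕ → S) : WithTop ℕ :=
  hittingAfter (fun n (w : ℕ → S) => w n) U 1 w

/-- The exit time `T_U = inf {n ≥ 0 : X_n ∉ U}`. -/
def exitTime {S : Type*} (U : Set S) (w : ℕ → S) : WithTop ℕ :=
  entranceTime Uᶜ w

/-! ### Capacities -/

/-- `cap_U(K)` on the cylinder: the sum over `x ∈ K` of the probability, starting from `x`, that the
walk leaves `U` before it returns to `K`. -/
def cylCap {d N : ℕ} (U : Set (Cyl d N)) (K : Finset (Cyl d N)) : ℝ :=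
  ∑ x ∈ K, (cylLaw d N x).real {w | exitTime U w < hitTime (K : Set (Cyl d N)) w}

/-- `cap(K)` on `ℤ^(d+1)`: the sum over `x ∈ K` of the probability, starting from `x`, that the walk
never returns to `K`. -/
def latticeCap {d : ℕ} (K : Finset (ZLat d)) : ℝ :=
  ∑ x ∈ K, (latticeLaw d x).real {w | hitTime (K : Set (ZLat d)) w = ⊤}

/-! ### Intervals, boundaries, blocks -/

/-- The outer boundary of a set of integers. -/
def bdry (U : Set ℤ) : Set ℤ := {z | z ∉ U ∧ ∃ z' ∈ U, |z - z'| = 1}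

/-- The inner boundary of a set of integers. -/
def innerBdry (U : Set ℤ) : Set ℤ := {z | z ∈ U ∧ ∃ z', z' ∉ U ∧ |z - z'| = 1}

/-- `ζ + [-δ, δ]`. -/
def smallInterval (δ : ℕ) (ζ : ℤ) : Set ℤ := Set.Icc (ζ - δ) (ζ + δ)

/-- `ζ + (-η, η)`. -/
def bigInterval (η : ℕ) (ζ : ℤ) : Set ℤ := Set.Ioo (ζ - η) (ζ + η)

/-- The part `𝕋 × I` of the cylinder. -/
def block (d N : ℕ) (I : Set ℤ) : Set (Cyl d N) := {p | p.2 ∈ I}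

/-! ### The grid and the excursions -/

/-- The grid with special points `ζ_1, …, ζ_L`: these points together with the points of `2ηℤ` at
distance at least `2η` from all of them. -/
def grid {L : ℕ} (η : ℕ) (ζ : Fin L → ℤ) : Set ℤ :=
  Set.range ζ ∪ {z | (∃ k : ℤ, z = 2 * η * k) ∧ ∀ l, 2 * (η : ℤ) ≤ |z - ζ l|}

/-- The set `𝕋 × (grid + [-δ, δ])`. -/
def returnRegion (d N : ℕ) {L : ℕ} (δ η : ℕ) (ζ : Fin L → ℤ) : Set (Cyl d N) :=
  block d N (⋃ g ∈ grid η ζ, smallInterval δ g)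

/-- The set `𝕋 × (grid + (-η, η))`. -/
def departureRegion (d N : ℕ) {L : ℕ} (η : ℕ) (ζ : Fin L → ℤ) : Set (Cyl d N) :=
  block d N (⋃ g ∈ grid η ζ, bigInterval η g)

/-- The first return time `R_1`, the entrance time of `𝕋 × (grid + [-δ, δ])`. -/
def firstReturn (d N : ℕ) {L : ℕ} (δ η : ℕ) (ζ : Fin L → ℤ) (w : ℕ → Cyl d N) : WithTop ℕ :=
  entranceTime (returnRegion d N δ η ζ) w

/-- The first departure time `D_1`: the first exit after `R_1` from `𝕋 × (grid + (-η, η))`, that is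
`R_1 + T ∘ θ_{R_1}` with `T` the exit time (and `∞` when `R_1 = ∞`). -/
def firstDeparture (d N : ℕ) {L : ℕ} (δ η : ℕ) (ζ : Fin L → ℤ) (w : ℕ → Cyl d N) : WithTop ℕ :=
  firstReturn d N δ η ζ w +
    exitTime (departureRegion d N η ζ) (fun k => w ((firstReturn d N δ η ζ w).untopD 0 + k))

/-- `P_{z,z'} = P_{ν_z}[ · | Z_{D_1} = z']`, where `Z` is the vertical component of the walk. -/
def excursionLaw (d N : ℕ) {L : ℕ} (δ η : ℕ) (ζ : Fin L → ℤ) (z z' : ℤ) :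
    Measure (ℕ → Cyl d N) :=
  cond (levelLaw d N z)
    {w | ∃ n : ℕ, firstDeparture d N δ η ζ w = (n : WithTop ℕ) ∧ (w n).2 = z'}

/-! ### The clusters of points -/

open Classical in
/-- The set of indices `i` with `v_i = a`. -/
def cluster {M : ℕ} (v : Fin M → ℝ) (a : ℝ) : Finset (Fin M) :=
  Finset.univ.filter (fun i => v i = a)

/-- The largest vertical component of the points `x_i` with `v_i = a` (a maximum when `a` is
one of the values of `v`). -/
def topHeight {d N M : ℕ} (x : Fin M → Cyl d N) (v : Fin M → ℝ) (a : ℝ) : ℤ :=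
  sSup ((fun i => (x i).2) '' (cluster v a : Set (Fin M)))

/-- The union of the sets `x_i + K_i` (that is, `x_i + π_E(K_i)`) over the `i` with `v_i = a`. -/
def clusterSet {d N M : ℕ} (x : Fin M → Cyl d N) (K : Fin M → Finset (ZLat d))
    (v : Fin M → ℝ) (a : ℝ) : Finset (Cyl d N) :=
  (cluster v a).biUnion (fun i => (K i).image (fun u => x i + proj d N u))

end

end CylinderWalk

open CylinderWalk

/-!
The probability `f` of hitting `C` before leaving the slab satisfies `f - stepAvg f = e` in the
slab, where `e` is the escape probability on `C` and `0` elsewhere. Summed over the levels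
`𝕋 × {z}`, this becomes a discrete Poisson equation on an interval of `ℤ`, so the walk started
uniformly on level `z` hits `C` with probability `(d + 1) / N ^ d` times the sum over `x ∈ C` of
`e x` times the explicit Green function at the heights of `x` and `z`. Near the centre of the slab
this Green function is `h (1 + O(δ / h))`. By gambler's ruin, a walk near the centre leaves the slab
through either end with probability `(1 + O(δ / h)) / 2`, so by the Markov property at the hitting
time of `C`, conditioning on the exit level costs only another factor `1 + O(δ / h)`.

For the capacities, a subsequential limit of the hitting probabilities of `C`, viewed from `x i`, is
a function on the lattice that is `1` on `K i` and harmonic elsewhere. It tends to `0` at infinity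
because the hitting probabilities are dominated by explicit superharmonic functions on the cylinder:
a power of a regularized squared distance, decaying like the Green function of `ℤ ^ (d + 1)`,
corrected by a concave function of the height of order `h / N ^ d`. The maximum principle then
identifies the limit with the hitting probability of `K i` by the lattice walk.
-/

namespace CylinderWalk

open scoped BigOperators

/-! ### The Markov property at time one -/

/-- The sequence with first term `q.1` followed by the sequence `q.2`. -/
def consSeq {T : Type*} (q : T × (ℕ → T)) : ℕ → T
  | 0 => q.1
  | n + 1 => q.2 n

theorem measurable_consSeq {T : Type*} [MeasurableSpace T] :
    Measurable (consSeq : T × (ℕ → T) → ℕ → T) := by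
  refine measurable_pi_lambda _ fun n => ?_
  cases n with
  | zero => exact measurable_fst
  | succ n => exact (measurable_pi_apply n).comp measurable_snd

theorem consSeq_preimage_pi_range {T : Type*} (t : ℕ → Set T) (k : ℕ) :
    consSeq ⁻¹' Set.pi (Finset.range (k + 1)) t =
      t 0 ×ˢ Set.pi (Finset.range k) fun n => t (n + 1) := by
  ext q
  simp only [Set.mem_preimage, Set.mem_pi, Finset.mem_coe, Finset.mem_range, Set.mem_prod]
  refine ⟨fun h => ⟨h 0 (by omega), fun n hn => h (n + 1) (by omega)⟩, fun h n hn => ?_⟩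
  cases n with
  | zero => exact h.1
  | succ n => exact h.2 n (by omega)

theorem map_consSeq_infinitePi {T : Type*} [MeasurableSpace T] (μ : Measure T)
    [IsProbabilityMeasure μ] :
    (μ.prod (Measure.infinitePi fun _ : ℕ => μ)).map consSeq =
      Measure.infinitePi fun _ : ℕ => μ := by
  refine Measure.eq_infinitePi _ fun S t ht => ?_
  obtain ⟨k, hk⟩ : ∃ k, S ⊆ Finset.range (k + 1) :=
    ⟨S.sup id, fun n hn => Finset.mem_range_succ_iff.2 (Finset.le_sup (f := id) hn)⟩
  obtain ⟨t', hin, hout⟩ : ∃ t' : ℕ → Set T, (∀ n ∈ S, t' n = t n) ∧ ∀ n ∉ S, t' n = Set.univ :=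
    ⟨fun n => if n ∈ S then t n else Set.univ, fun n hn => if_pos hn, fun n hn => if_neg hn⟩
  have ht' : ∀ n, MeasurableSet (t' n) := fun n => by
    by_cases hn : n ∈ S
    exacts [hin n hn ▸ ht n, hout n hn ▸ MeasurableSet.univ]
  have hbox : Set.pi S t = Set.pi (Finset.range (k + 1)) t' := by
    ext w
    refine ⟨fun h n _ => ?_, fun h n hn => hin n hn ▸ h n (hk hn)⟩
    by_cases hn : n ∈ S
    exacts [hin n hn ▸ h n hn, hout n hn ▸ Set.mem_univ _]
  have hprod : ∏ n ∈ S, μ (t n) = ∏ n ∈ Finset.range (k + 1), μ (t' n) := by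
    rw [← Finset.prod_subset hk fun n _ hn => by rw [hout n hn, measure_univ]]
    exact Finset.prod_congr rfl fun n hn => by rw [hin n hn]
  rw [hprod, hbox, Measure.map_apply measurable_consSeq
      (.pi (Finset.countable_toSet _) fun n _ => ht' n), consSeq_preimage_pi_range,
    Measure.prod_prod, Measure.infinitePi_pi _ fun n _ => ht' (n + 1),
    Finset.prod_range_succ', mul_comm]

/-- The average of `f` over the points that a walk with steps `s` can reach from `x` in one step:
the transition operator of the walk. -/
noncomputable def stepAvg {ι G : Type*} [Fintype ι] [Add G] (s : ι → G) (f : G → ℝ) (x : G) : ℝ :=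
  𝔼 p, f (x + s p)

section stepAvg

variable {ι G : Type*} [Fintype ι] [Add G] (s : ι → G) {f g : G → ℝ} {x : G}

theorem stepAvg_congr (h : ∀ p, f (x + s p) = g (x + s p)) : stepAvg s f x = stepAvg s g x :=
  Finset.expect_congr rfl fun p _ => h p

theorem stepAvg_mono (h : ∀ p, f (x + s p) ≤ g (x + s p)) : stepAvg s f x ≤ stepAvg s g x :=
  Finset.expect_le_expect fun p _ => h p

theorem stepAvg_sub : stepAvg s (fun y => f y - g y) x = stepAvg s f x - stepAvg s g x :=
  Finset.expect_sub_distrib _ _ _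

theorem stepAvg_const_mul (a : ℝ) : stepAvg s (fun y => a * f y) x = a * stepAvg s f x :=
  (Finset.mul_expect _ _ _).symm

theorem stepAvg_sum {κ : Type*} (J : Finset κ) (f : κ → G → ℝ) :
    stepAvg s (fun y => ∑ j ∈ J, f j y) x = ∑ j ∈ J, stepAvg s (f j) x :=
  Finset.expect_sum_comm _ _ _

theorem stepAvg_const [Nonempty ι] (a : ℝ) : stepAvg s (fun _ => a) x = a :=
  Fintype.expect_const a

theorem tendsto_stepAvg {κ : Type*} {l : Filter κ} {F : κ → G → ℝ}
    (h : ∀ y, Tendsto (F · y) l (𝓝 (f y))) (x : G) :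
    Tendsto (fun n => stepAvg s (F n) x) l (𝓝 (stepAvg s f x)) := by
  simp only [stepAvg, Fintype.expect_eq_sum_div_card]
  exact (tendsto_finsetSum _ fun p _ => h _).div_const _

theorem stepAvg_translate {G : Type*} [AddCommGroup G] (s : ι → G) (f : G → ℝ) (c x : G) :
    stepAvg s (fun y => f (y - c)) x = stepAvg s f (x - c) := by
  simp only [stepAvg, add_sub_right_comm]

end stepAvg

/-- The trajectory with starting point `x` and increments `s (ω n)`. -/
def walkPath {ι G : Type*} [AddCommGroup G] (s : ι → G) (x : G) (ω : ℕ → ι) (n : ℕ) : G :=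
  x + ∑ k ∈ Finset.range n, s (ω k)

theorem walkPath_zero {ι G : Type*} [AddCommGroup G] (s : ι → G) (x : G) (ω : ℕ → ι) :
    walkPath s x ω 0 = x := by
  simp [walkPath]

theorem walkPath_consSeq_succ {ι G : Type*} [AddCommGroup G] (s : ι → G) (x : G)
    (q : ι × (ℕ → ι)) (n : ℕ) :
    walkPath s x (consSeq q) (n + 1) = walkPath s (x + s q.1) q.2 n := by
  simp only [walkPath, Finset.sum_range_succ', consSeq]
  abel

section walkLaw

variable {d : ℕ} {G : Type*} [AddCommGroup G] [MeasurableSpace G] [Countable G]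
  [MeasurableSingletonClass G] (s : Fin (d + 1) × Bool → G) (x : G)

theorem measurable_walkPath : Measurable (walkPath s x) := by
  have : MeasurableAdd₂ G := ⟨Measurable.of_discrete⟩
  refine measurable_pi_lambda _ fun n =>
    measurable_const.add (Finset.measurable_sum _ fun k _ => ?_)
  exact (Measurable.of_discrete (f := s)).comp (measurable_pi_apply k)

theorem walkLaw_apply {A : Set (ℕ → G)} (hA : MeasurableSet A) :
    walkLaw s x A = Measure.infinitePi
      (fun _ : ℕ => (PMF.uniformOfFintype (Fin (d + 1) × Bool)).toMeasure)
        (walkPath s x ⁻¹' A) :=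
  Measure.map_apply (measurable_walkPath s x) hA

instance : IsProbabilityMeasure (walkLaw s x) :=
  Measure.isProbabilityMeasure_map (measurable_walkPath s x).aemeasurable

theorem ae_walkLaw_zero : ∀ᵐ w ∂walkLaw s x, w 0 = x := by
  refine (ae_map_iff (measurable_walkPath s x).aemeasurable
    (measurable_pi_apply 0 (measurableSet_singleton x))).2 (.of_forall fun ω => walkPath_zero s x ω)

theorem walkLaw_real_congr {A B : Set (ℕ → G)} (h : ∀ w : ℕ → G, w 0 = x → (w ∈ A ↔ w ∈ B)) :
    (walkLaw s x).real A = (walkLaw s x).real B :=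
  measureReal_congr ((ae_walkLaw_zero s x).mono fun w hw => propext (h w hw))

theorem walkLaw_real_eq_one {A : Set (ℕ → G)} (h : ∀ w : ℕ → G, w 0 = x → w ∈ A) :
    (walkLaw s x).real A = 1 := by
  rw [walkLaw_real_congr s x (B := Set.univ) (by simpa using h), probReal_univ]

theorem walkLaw_real_eq_zero {A : Set (ℕ → G)} (h : ∀ w : ℕ → G, w 0 = x → w ∉ A) :
    (walkLaw s x).real A = 0 := by
  rw [walkLaw_real_congr s x (B := ∅) (by simpa using h), measureReal_empty]

theorem walkLaw_shift_apply {A : Set (ℕ → G)} (hA : MeasurableSet A) :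
    walkLaw s x {w | (fun n => w (n + 1)) ∈ A} =
      ∑ p, (Fintype.card (Fin (d + 1) × Bool) : ℝ≥0∞)⁻¹ * walkLaw s (x + s p) A := by
  set μ := (PMF.uniformOfFintype (Fin (d + 1) × Bool)).toMeasure with hμ
  have : IsProbabilityMeasure μ := by rw [hμ]; infer_instance
  have hshift : MeasurableSet {w : ℕ → G | (fun n => w (n + 1)) ∈ A} :=
    measurable_pi_lambda (fun (w : ℕ → G) n => w (n + 1)) (fun n => measurable_pi_apply (n + 1)) hA
  have hpath := measurable_walkPath s x hshift
  rw [walkLaw_apply s x hshift, ← hμ, ← map_consSeq_infinitePi μ,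
    Measure.map_apply measurable_consSeq hpath, Measure.prod_apply (measurable_consSeq hpath),
    lintegral_fintype]
  refine Finset.sum_congr rfl fun p _ => ?_
  rw [mul_comm, hμ, PMF.toMeasure_apply_singleton _ _ (measurableSet_singleton p),
    PMF.uniformOfFintype_apply, walkLaw_apply _ _ hA]
  congr 2
  ext ω
  simp only [Set.mem_preimage, Set.mem_ofPred_eq, walkPath_consSeq_succ]

theorem walkLaw_real_shift {A : Set (ℕ → G)} (hA : MeasurableSet A) :
    (walkLaw s x).real {w | (fun n => w (n + 1)) ∈ A} =
      stepAvg s (fun y => (walkLaw s y).real A) x := by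
  rw [measureReal_def, walkLaw_shift_apply s x hA, stepAvg, Fintype.expect_eq_sum_div_card,
    ENNReal.toReal_sum fun p _ => ENNReal.mul_ne_top (by simp) (measure_ne_top _ _),
    Finset.sum_div]
  refine Finset.sum_congr rfl fun p _ => ?_
  rw [ENNReal.toReal_mul, ENNReal.toReal_inv, ENNReal.toReal_natCast, inv_mul_eq_div,
    measureReal_def]

theorem walkLaw_real_eq_stepAvg {A B : Set (ℕ → G)} (hB : MeasurableSet B)
    (h : ∀ w : ℕ → G, w 0 = x → (w ∈ A ↔ (fun n => w (n + 1)) ∈ B)) :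
    (walkLaw s x).real A = stepAvg s (fun y => (walkLaw s y).real B) x :=
  (walkLaw_real_congr s x h).trans (walkLaw_real_shift s x hB)

end walkLaw

/-! ### The maximum principle -/

section MaximumPrinciple

variable {ι G : Type*} [Fintype ι] [AddCommGroup G] {s : ι → G} {f g : G → ℝ}

/-- A positive maximum would propagate along a step of infinite order. -/
theorem nonpos_of_subharmonic (hs : ∃ p, ¬ IsOfFinAddOrder (s p))
    (hfin : ∀ ε > 0, {x | ε ≤ f x}.Finite) (hsub : ∀ x, 0 < f x → f x ≤ stepAvg s f x) (x : G) :
    f x ≤ 0 := by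
  by_contra! hx
  obtain ⟨p₀, hp₀⟩ := hs
  have : Nonempty ι := ⟨p₀⟩
  obtain ⟨a, ha, hmax'⟩ := Set.exists_max_image {y | f x ≤ f y} f (hfin _ hx) ⟨x, le_refl (f x)⟩
  have hmax : ∀ y, f y ≤ f a := fun y =>
    (le_total (f x) (f y)).elim (hmax' y) fun h => h.trans ha
  have hpos : 0 < f a := hx.trans_le ha
  have hstep : ∀ y, f y = f a → f (y + s p₀) = f a := by
    intro y hy
    have hle : 𝔼 p, (f a - f (y + s p)) ≤ 0 := by
      rw [Finset.expect_sub_distrib, Fintype.expect_const, ← hy, sub_nonpos]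
      exact hsub y (hy ▸ hpos)
    have hnonneg : ∀ p ∈ Finset.univ, 0 ≤ f a - f (y + s p) := fun p _ => sub_nonneg.2 (hmax _)
    have h0 := (Finset.expect_eq_zero_iff_of_nonneg hnonneg).1
      (hle.antisymm (Finset.expect_nonneg hnonneg)) p₀ (Finset.mem_univ p₀)
    exact (sub_eq_zero.1 h0).symm
  have hline : ∀ n : ℕ, f (a + n • s p₀) = f a := by
    intro n
    induction n with
    | zero => simp
    | succ n ih => rw [succ_nsmul, ← add_assoc]; exact hstep _ ih
  have hinj : Function.Injective fun n : ℕ => a + n • s p₀ :=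
    (add_right_injective a).comp (injective_nsmul_iff_not_isOfFinAddOrder.2 hp₀)
  refine Set.infinite_range_of_injective hinj ((hfin _ hpos).subset ?_)
  rintro _ ⟨n, rfl⟩
  exact (hline n).ge

theorem le_of_sub_stepAvg_le (hs : ∃ p, ¬ IsOfFinAddOrder (s p)) {B : Set G}
    (hB : B.Finite) (hbdry : ∀ x ∈ B, ∀ p, x + s p ∉ B → f (x + s p) ≤ g (x + s p))
    (hle : ∀ x ∈ B, f x ≤ g x ∨ f x - stepAvg s f x ≤ g x - stepAvg s g x) :
    ∀ x ∈ B, f x ≤ g x := by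
  classical
  intro x hx
  have hmem : ∀ y, 0 < B.indicator (fun y => f y - g y) y → y ∈ B := fun y hy => by
    by_contra hyB
    simp [hyB] at hy
  have key := nonpos_of_subharmonic (f := B.indicator fun y => f y - g y) hs
    (fun ε hε => hB.subset fun y hy => hmem y (hε.trans_le hy)) (fun y hy => ?_) x
  · simpa [hx] using key
  have hyB := hmem y hy
  rw [Set.indicator_of_mem hyB] at hy ⊢
  have hlap := (hle y hyB).resolve_left (not_le.2 (sub_pos.1 hy))
  calc f y - g y ≤ stepAvg s (fun z => f z - g z) y := by rw [stepAvg_sub]; linarith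
    _ ≤ _ := stepAvg_mono s fun p => by
      by_cases hp : y + s p ∈ B
      · rw [Set.indicator_of_mem hp]
      · rw [Set.indicator_of_notMem hp]; exact sub_nonpos.2 (hbdry y hyB p hp)

theorem eqOn_of_sub_stepAvg_eq (hs : ∃ p, ¬ IsOfFinAddOrder (s p)) {B : Set G} (hB : B.Finite)
    (hbdry : ∀ x ∈ B, ∀ p, x + s p ∉ B → f (x + s p) = g (x + s p))
    (heq : ∀ x ∈ B, f x = g x ∨ f x - stepAvg s f x = g x - stepAvg s g x) : Set.EqOn f g B :=
  fun x hx => le_antisymm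
    (le_of_sub_stepAvg_le hs hB (fun y hy p hp => (hbdry y hy p hp).le)
      (fun y hy => (heq y hy).imp Eq.le Eq.le) x hx)
    (le_of_sub_stepAvg_le hs hB (fun y hy p hp => (hbdry y hy p hp).ge)
      (fun y hy => (heq y hy).imp Eq.ge Eq.ge) x hx)

end MaximumPrinciple

/-! ### Reaching a set through another one -/

/-- The trajectories that visit `C` and stay in `B` strictly before their first visit to `C`. With
`C ⊆ B` this is the event of hitting `C` before leaving `B`, and with `C` disjoint from `B` it is
the event of leaving `B` through `C`. -/
def reach {S : Type*} (B C : Set S) : Set (ℕ → S) := {w | ∃ n, w n ∈ C ∧ ∀ m < n, w m ∈ B}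

section Path

variable {S : Type*} {B C U V : Set S} {w : ℕ → S}

theorem mem_reach_iff :
    w ∈ reach B C ↔ w 0 ∈ C ∨ w 0 ∈ B ∧ (fun n => w (n + 1)) ∈ reach B C := by
  constructor
  · rintro ⟨_ | n, hn, h⟩
    · exact .inl hn
    · exact .inr ⟨h 0 (by omega), n, hn, fun m hm => h (m + 1) (by omega)⟩
  · rintro (h0 | ⟨h0, n, hn, h⟩)
    · exact ⟨0, h0, fun m hm => absurd hm m.not_lt_zero⟩
    · refine ⟨n + 1, hn, fun m hm => ?_⟩
      cases m with
      | zero => exact h0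
      | succ m => exact h m (by omega)

theorem hittingAfter_lt_hittingAfter_iff (k l : ℕ) :
    hittingAfter (fun n (w : ℕ → S) => w n) U k w < hittingAfter (fun n (w : ℕ → S) => w n) V l w ↔
      ∃ n ≥ k, w n ∈ U ∧ ∀ m ≥ l, m ≤ n → w m ∉ V := by
  constructor
  · intro h
    lift hittingAfter (fun n (w : ℕ → S) => w n) U k w to ℕ using h.ne_top with n hn
    obtain ⟨m, hm, hmU⟩ := hittingAfter_le_iff.1 hn.ge
    exact ⟨m, hm.1, hmU, fun j hj hjm => notMem_of_lt_hittingAfter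
      ((WithTop.coe_le_coe.2 (hjm.trans hm.2)).trans_lt h) hj⟩
  · rintro ⟨n, hn, hnU, h⟩
    refine (hittingAfter_le_of_mem hn hnU).trans_lt (lt_of_not_ge fun hle => ?_)
    obtain ⟨m, hm, hmV⟩ := hittingAfter_le_iff.1 hle
    exact h m hm.1 hm.2 hmV

theorem hittingAfter_eq_coe_iff (k n : ℕ) :
    hittingAfter (fun n (w : ℕ → S) => w n) U k w = (n : WithTop ℕ) ↔
      (k ≤ n ∧ w n ∈ U) ∧ ∀ m ≥ k, m < n → w m ∉ U := by
  constructor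
  · intro h
    obtain ⟨m, hm, hmU⟩ := hittingAfter_le_iff.1 h.le
    have hlt : ∀ j ≥ k, j < n → w j ∉ U := fun j hj hjn =>
      notMem_of_lt_hittingAfter ((WithTop.coe_lt_coe.2 hjn).trans_eq h.symm) hj
    obtain rfl : m = n := hm.2.antisymm (not_lt.1 fun hmn => hlt m hm.1 hmn hmU)
    exact ⟨⟨hm.1, hmU⟩, hlt⟩
  · rintro ⟨⟨hk, hn⟩, hlt⟩
    refine (hittingAfter_le_of_mem hk hn).antisymm (not_lt.1 fun h => ?_)
    obtain ⟨m, hm, hmU⟩ := hittingAfter_lt_iff.1 h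
    exact hlt m hm.1 hm.2 hmU

theorem entranceTime_lt_exitTime_iff (hCB : C ⊆ B) :
    entranceTime C w < exitTime B w ↔ w ∈ reach B C := by
  rw [exitTime, entranceTime, entranceTime, hittingAfter_lt_hittingAfter_iff]
  simp only [ge_iff_le, zero_le, true_and, forall_const, Set.mem_compl_iff, not_not]
  refine exists_congr fun n => and_congr_right fun hn => ⟨fun h m hm => h m hm.le, fun h m hm => ?_⟩
  obtain rfl | hm := hm.eq_or_lt
  exacts [hCB hn, h m hm]

theorem exitTime_lt_hitTime_iff (hCB : C ⊆ B) (h0 : w 0 ∈ B) :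
    exitTime B w < hitTime C w ↔ (fun n => w (n + 1)) ∈ reach Cᶜ Bᶜ := by
  rw [exitTime, entranceTime, hitTime, hittingAfter_lt_hittingAfter_iff]
  constructor
  · rintro ⟨_ | n, -, hn, h⟩
    · exact absurd h0 hn
    · exact ⟨n, hn, fun m hm => h (m + 1) (by omega) (by omega)⟩
  · rintro ⟨n, hn, h⟩
    refine ⟨n + 1, n.succ.zero_le, hn, fun m hm hmn => ?_⟩
    obtain ⟨m, rfl⟩ := Nat.exists_eq_add_of_le' hm
    obtain rfl | hlt := (Nat.le_of_succ_le_succ hmn).eq_or_lt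
    exacts [fun hC => hn (hCB hC), h m hlt]

theorem hitTime_eq_top_iff : hitTime C w = ⊤ ↔ (fun n => w (n + 1)) ∉ reach Set.univ C := by
  rw [hitTime, hittingAfter_eq_top_iff]
  simp only [reach, Set.mem_ofPred_eq, Set.mem_univ, implies_true, and_true, not_exists]
  refine ⟨fun h n => h (n + 1) (by omega), fun h n hn => ?_⟩
  obtain ⟨m, rfl⟩ := Nat.exists_eq_add_of_le' hn
  exact h m

theorem measurableSet_reach {G : Type*} [MeasurableSpace G] [Countable G]
    [MeasurableSingletonClass G] (B C : Set G) : MeasurableSet (reach B C) := by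
  have hcoord : ∀ (n : ℕ) (U : Set G), MeasurableSet {w : ℕ → G | w n ∈ U} := fun n U =>
    measurable_pi_apply n (Set.to_countable U).measurableSet
  simp only [reach, Set.ofPred_exists, Set.ofPred_and, Set.ofPred_forall]
  exact .iUnion fun n => (hcoord n C).inter (.iInter fun m => .iInter fun _ => hcoord m B)

end Path

/-- The probability that the walk with steps `s` started at `x` visits `C` while staying in `B`
before. -/
noncomputable def reachProb {d : ℕ} {G : Type*} [AddCommGroup G] [MeasurableSpace G]
    (s : Fin (d + 1) × Bool → G) (B C : Set G) (x : G) : ℝ :=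
  (walkLaw s x).real (reach B C)

theorem reachProb_nonneg {d : ℕ} {G : Type*} [AddCommGroup G] [MeasurableSpace G]
    {s : Fin (d + 1) × Bool → G} {B C : Set G} {x : G} : 0 ≤ reachProb s B C x :=
  measureReal_nonneg

section reachProb

variable {d : ℕ} {G : Type*} [AddCommGroup G] [MeasurableSpace G] [Countable G]
  [MeasurableSingletonClass G] {s : Fin (d + 1) × Bool → G} {A B C R : Set G} {x : G}

theorem reachProb_le_one : reachProb s B C x ≤ 1 := measureReal_le_one

theorem reachProb_of_mem (hC : x ∈ C) : reachProb s B C x = 1 :=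
  walkLaw_real_eq_one s x fun _ hw => mem_reach_iff.2 (.inl (hw ▸ hC))

theorem reachProb_of_notMem (hB : x ∉ B) (hC : x ∉ C) : reachProb s B C x = 0 :=
  walkLaw_real_eq_zero s x fun _ hw h =>
    (mem_reach_iff.1 h).elim (fun h0 => hC (hw ▸ h0)) fun h0 => hB (hw ▸ h0.1)

theorem reachProb_eq_stepAvg (hB : x ∈ B) (hC : x ∉ C) :
    reachProb s B C x = stepAvg s (reachProb s B C) x :=
  walkLaw_real_eq_stepAvg s x (measurableSet_reach B C) fun w hw => by
    rw [mem_reach_iff (w := w), hw]; simp [hB, hC]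

theorem walkLaw_real_reach_inter_of_mem (hC : x ∈ C) :
    (walkLaw s x).real (reach B C ∩ reach R A) = reachProb s R A x :=
  walkLaw_real_congr s x fun w hw => by
    rw [Set.mem_inter_iff, mem_reach_iff (B := B), hw]; simp [hC]

theorem walkLaw_real_reach_inter_of_notMem (hB : x ∉ B) (hC : x ∉ C) :
    (walkLaw s x).real (reach B C ∩ reach R A) = 0 :=
  walkLaw_real_eq_zero s x fun w hw h => by
    have := mem_reach_iff.1 h.1
    simp [hw, hB, hC] at this

theorem walkLaw_real_reach_inter_eq_stepAvg (hB : x ∈ B) (hC : x ∉ C) (hR : x ∈ R) (hA : x ∉ A) :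
    (walkLaw s x).real (reach B C ∩ reach R A) =
      stepAvg s (fun y => (walkLaw s y).real (reach B C ∩ reach R A)) x :=
  walkLaw_real_eq_stepAvg s x ((measurableSet_reach B C).inter (measurableSet_reach R A))
    fun w hw => by
      rw [Set.mem_inter_iff, mem_reach_iff (w := w), mem_reach_iff (w := w), hw]
      simp [hB, hC, hR, hA]

section FiniteDomain

variable (hs : ∃ p, ¬ IsOfFinAddOrder (s p)) (hB : B.Finite) (hCB : C ⊆ B)

include hs hB hCB

theorem mul_reachProb_le {u : G → ℝ} {b : ℝ}
    (hu₀ : ∀ y ∈ B, ∀ p, y + s p ∉ B → 0 ≤ u (y + s p)) (hub : ∀ y ∈ C, b ≤ u y)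
    (hu : ∀ y ∈ B, y ∉ C → stepAvg s u y ≤ u y) (hx : x ∈ B) : b * reachProb s B C x ≤ u x := by
  refine le_of_sub_stepAvg_le (f := fun y => b * reachProb s B C y) hs hB
    (fun y hy p hp => ?_) (fun y hy => ?_) x hx
  · simpa only [reachProb_of_notMem hp fun h => hp (hCB h), mul_zero] using hu₀ y hy p hp
  by_cases hyC : y ∈ C
  · exact .inl (by simpa only [reachProb_of_mem hyC, mul_one] using hub y hyC)
  · rw [stepAvg_const_mul, ← reachProb_eq_stepAvg hy hyC, sub_self]
    exact .inr (sub_nonneg.2 (hu y hy hyC))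

theorem le_mul_reachProb {u : G → ℝ} {b : ℝ}
    (hu₀ : ∀ y ∈ B, ∀ p, y + s p ∉ B → u (y + s p) ≤ 0) (hub : ∀ y ∈ C, u y ≤ b)
    (hu : ∀ y ∈ B, y ∉ C → u y ≤ stepAvg s u y) (hx : x ∈ B) : u x ≤ b * reachProb s B C x := by
  have := mul_reachProb_le (u := fun y => -1 * u y) (b := -b) hs hB hCB
    (fun y hy p hp => by linarith [hu₀ y hy p hp]) (fun y hy => by linarith [hub y hy])
    (fun y hy hyC => by rw [stepAvg_const_mul]; linarith [hu y hy hyC]) hx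
  linarith

theorem mul_reachProb_le_inter (hBR : B ⊆ R) (hAB : Disjoint B A) {b : ℝ}
    (hb : ∀ y ∈ C, b ≤ reachProb s R A y) (hx : x ∈ B) :
    b * reachProb s B C x ≤ (walkLaw s x).real (reach B C ∩ reach R A) :=
  mul_reachProb_le (u := fun y => (walkLaw s y).real (reach B C ∩ reach R A)) hs hB hCB
    (fun _ _ _ _ => measureReal_nonneg)
    (fun y hy => (hb y hy).trans (walkLaw_real_reach_inter_of_mem hy).ge)
    (fun _ hy hyC => (walkLaw_real_reach_inter_eq_stepAvg hy hyC (hBR hy)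
      (hAB.notMem_of_mem_left hy)).ge) hx

theorem inter_le_mul_reachProb (hBR : B ⊆ R) (hAB : Disjoint B A) {b : ℝ}
    (hb : ∀ y ∈ C, reachProb s R A y ≤ b) (hx : x ∈ B) :
    (walkLaw s x).real (reach B C ∩ reach R A) ≤ b * reachProb s B C x :=
  le_mul_reachProb (u := fun y => (walkLaw s y).real (reach B C ∩ reach R A)) hs hB hCB
    (fun _ _ _ hp => (walkLaw_real_reach_inter_of_notMem hp fun h => hp (hCB h)).le)
    (fun y hy => (walkLaw_real_reach_inter_of_mem hy).le.trans (hb y hy))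
    (fun _ hy hyC => (walkLaw_real_reach_inter_eq_stepAvg hy hyC (hBR hy)
      (hAB.notMem_of_mem_left hy)).le) hx

/-- The walk leaves the finite set `B` almost surely, so it either visits `C` first or leaves `B`
first. -/
theorem reachProb_compl_compl (x : G) : reachProb s Cᶜ Bᶜ x = 1 - reachProb s B C x := by
  have hout : ∀ y ∉ B, reachProb s Cᶜ Bᶜ y = 1 - reachProb s B C y := fun y hy => by
    rw [reachProb_of_mem (show y ∈ Bᶜ from hy), reachProb_of_notMem hy fun h => hy (hCB h),
      sub_zero]
  by_cases hx : x ∈ B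
  · refine eqOn_of_sub_stepAvg_eq (g := fun y => 1 - reachProb s B C y) hs hB
      (fun y _ p hp => hout _ hp) (fun y hy => ?_) hx
    by_cases hyC : y ∈ C
    · left
      rw [reachProb_of_mem hyC, reachProb_of_notMem (not_not.2 hyC) (not_not.2 hy), sub_self]
    · right
      rw [stepAvg_sub, stepAvg_const, ← reachProb_eq_stepAvg hy hyC,
        ← reachProb_eq_stepAvg hyC (not_not.2 hy), sub_self, sub_self]
  · exact hout x hx

theorem walkLaw_real_exitTime_lt_hitTime (hx : x ∈ B) :
    (walkLaw s x).real {w | exitTime B w < hitTime C w} = 1 - stepAvg s (reachProb s B C) x := by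
  rw [walkLaw_real_eq_stepAvg s x (A := {w | exitTime B w < hitTime C w})
      (measurableSet_reach Cᶜ Bᶜ) fun w hw => exitTime_lt_hitTime_iff hCB (hw ▸ hx),
    ← stepAvg_const s (x := x) 1, ← stepAvg_sub]
  exact stepAvg_congr s fun p => reachProb_compl_compl hs hB hCB _

end FiniteDomain

theorem walkLaw_real_hitTime_eq_top :
    (walkLaw s x).real {w | hitTime C w = ⊤} = 1 - stepAvg s (reachProb s Set.univ C) x := by
  rw [walkLaw_real_eq_stepAvg s x (A := {w | hitTime C w = ⊤})
      (measurableSet_reach Set.univ C).compl fun w _ => hitTime_eq_top_iff,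
    ← stepAvg_const s (x := x) 1, ← stepAvg_sub]
  exact stepAvg_congr s fun p => probReal_compl_eq_one_sub (measurableSet_reach _ _)

section WholeSpace

variable (hs : ∃ p, ¬ IsOfFinAddOrder (s p)) (hC : C.Finite) {u : G → ℝ}

theorem tendsto_reachProb_union (C : Set G) (x : G) :
    Tendsto (fun B : Finset G => reachProb s (B ∪ C) C x) atTop (𝓝 (reachProb s Set.univ C x)) := by
  classical
  have hmono : Monotone fun B : Finset G => reach (B ∪ C : Set G) C := fun A B hAB w ⟨n, hn, h⟩ =>
    ⟨n, hn, fun m hm => (h m hm).imp_left (@hAB (w m))⟩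
  have hunion : ⋃ B : Finset G, reach (B ∪ C : Set G) C = reach Set.univ C := by
    refine Set.Subset.antisymm (Set.iUnion_subset fun B w ⟨n, hn, _⟩ =>
      ⟨n, hn, fun _ _ => trivial⟩) fun w ⟨n, hn, _⟩ => ?_
    exact Set.mem_iUnion.2 ⟨(Finset.range n).image w, n, hn, fun m hm =>
      .inl (Finset.mem_coe.2 (Finset.mem_image_of_mem w (Finset.mem_range.2 hm)))⟩
  have hlim := tendsto_measure_iUnion_atTop (μ := walkLaw s x) hmono
  rw [hunion] at hlim
  exact (ENNReal.tendsto_toReal (measure_ne_top _ _)).comp hlim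

include hs hC

theorem reachProb_univ_le (hu₀ : ∀ y, 0 ≤ u y) (hu₁ : ∀ y ∈ C, 1 ≤ u y)
    (hu : ∀ y ∉ C, stepAvg s u y ≤ u y) (x : G) : reachProb s Set.univ C x ≤ u x := by
  refine le_of_tendsto (tendsto_reachProb_union C x)
    ((eventually_ge_atTop {x}).mono fun B hB => ?_)
  simpa only [one_mul] using mul_reachProb_le hs (B.finite_toSet.union hC) Set.subset_union_right
    (fun y _ p _ => hu₀ _) hu₁ (fun y _ hy => hu y hy)
    (.inl (Finset.mem_coe.2 (Finset.singleton_subset_iff.1 hB)))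

theorem eq_reachProb_univ (hu₀ : ∀ y, 0 ≤ u y) (hu₁ : ∀ y ∈ C, u y = 1)
    (hu : ∀ y ∉ C, u y = stepAvg s u y) (hlim : Tendsto u cofinite (𝓝 0)) (x : G) :
    u x = reachProb s Set.univ C x := by
  refine le_antisymm ?_ (reachProb_univ_le hs hC hu₀ (fun y hy => (hu₁ y hy).ge)
    (fun y hy => (hu y hy).ge) x)
  refine sub_nonpos.1 (nonpos_of_subharmonic (f := fun y => u y - reachProb s Set.univ C y) hs
    (fun ε hε => ?_) (fun y hy => ?_) x)
  · have hfinite : {y | ¬ u y < ε}.Finite := hlim.eventually_lt_const hε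
    refine hfinite.subset fun y (hy : ε ≤ _) => ?_
    exact not_lt.2 (hy.trans (sub_le_self _ reachProb_nonneg))
  · have hyC : y ∉ C := fun h => by simp [hu₁ y h, reachProb_of_mem h] at hy
    rw [stepAvg_sub, ← hu y hyC, ← reachProb_eq_stepAvg (Set.mem_univ y) hyC]

end WholeSpace

end reachProb

/-! ### The walk on the cylinder -/

/-- The steps of simple random walk on the cylinder. -/
abbrev cylStep (d N : ℕ) (p : Fin (d + 1) × Bool) : Cyl d N := proj d N (unitStep d p)

instance countable_zmod (N : ℕ) : Countable (ZMod N) := by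
  cases N with
  | zero => exact inferInstanceAs (Countable ℤ)
  | succ n => exact inferInstanceAs (Countable (Fin (n + 1)))

theorem cylStep_last (d N : ℕ) (b : Bool) :
    cylStep d N (Fin.last d, b) = (0, if b then 1 else -1) := by
  refine Prod.ext ?_ ?_
  · funext j
    simp [cylStep, proj, unitStep, Fin.castSucc_ne_last]
  · simp [cylStep, proj, unitStep]

theorem cylStep_castSucc (d N : ℕ) (j : Fin d) (b : Bool) :
    cylStep d N (j.castSucc, b) = (Pi.single j (if b then 1 else -1), 0) := by
  refine Prod.ext ?_ ?_
  · funext i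
    cases b <;> by_cases h : i = j <;>
      simp [cylStep, proj, unitStep, Pi.single_apply, h]
  · simp [cylStep, proj, unitStep, Pi.single_apply, (Fin.castSucc_ne_last j).symm]

theorem not_isOfFinAddOrder_cylStep_last (d N : ℕ) :
    ¬ IsOfFinAddOrder (cylStep d N (Fin.last d, true)) := by
  rw [← injective_nsmul_iff_not_isOfFinAddOrder]
  intro m n h
  simpa [cylStep_last] using congrArg Prod.snd h

theorem exists_not_isOfFinAddOrder_cylStep (d N : ℕ) : ∃ p, ¬ IsOfFinAddOrder (cylStep d N p) :=
  ⟨_, not_isOfFinAddOrder_cylStep_last d N⟩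

theorem sum_cylStep {d N : ℕ} (f : Cyl d N → ℝ) (y : Torus d N) (z : ℤ) :
    ∑ p, f ((y, z) + cylStep d N p) =
      ∑ j : Fin d, (f (y + Pi.single j 1, z) + f (y + Pi.single j (-1), z)) +
        (f (y, z + 1) + f (y, z - 1)) := by
  rw [Fintype.sum_prod_type, Fin.sum_univ_castSucc]
  simp only [Fintype.sum_bool, cylStep_last, cylStep_castSucc, Prod.mk_add_mk, if_true,
    Bool.false_eq_true, if_false, add_zero, sub_eq_add_neg]

theorem stepAvg_eq_sum_div {d : ℕ} {G : Type*} [Add G] (s : Fin (d + 1) × Bool → G) (f : G → ℝ)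
    (x : G) : stepAvg s f x = (∑ p, f (x + s p)) / (2 * (d + 1)) := by
  rw [stepAvg, Fintype.expect_eq_sum_div_card, Fintype.card_prod, Fintype.card_fin,
    Fintype.card_bool, mul_comm (2 : ℝ)]
  push_cast
  rfl

theorem stepAvg_height {d N : ℕ} (a b : ℝ) (x : Cyl d N) :
    stepAvg (cylStep d N) (fun y => a + b * y.2) x = a + b * x.2 := by
  obtain ⟨y, z⟩ := x
  rw [stepAvg_eq_sum_div, sum_cylStep (fun y : Cyl d N => a + b * (y.2 : ℝ))]
  simp only [Finset.sum_const, Finset.card_univ, Fintype.card_fin, nsmul_eq_mul]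
  push_cast
  field_simp
  ring

/-! ### Slabs and exit levels -/

theorem smallInterval_subset_bigInterval {δ η : ℕ} (h : δ < η) (ζ : ℤ) :
    smallInterval δ ζ ⊆ bigInterval η ζ := by
  rintro a ⟨h1, h2⟩
  constructor <;> omega

theorem mem_bdry_bigInterval {η : ℕ} {ζ z : ℤ} (hz : z ∈ bdry (bigInterval η ζ)) :
    ∃ σ : ℤ, (σ = 1 ∨ σ = -1) ∧ z = ζ + σ * η := by
  obtain ⟨hz_notMem, z', ⟨hlower, hupper⟩, hadj⟩ := hz
  have hz_out : ¬ (ζ - η < z ∧ z < ζ + η) := hz_notMem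
  rcases (abs_eq zero_le_one).1 hadj with h | h
  · exact ⟨1, .inl rfl, by omega⟩
  · exact ⟨-1, .inr rfl, by omega⟩

theorem finite_block {d N : ℕ} [NeZero N] (η : ℕ) (ζ : ℤ) : (block d N (bigInterval η ζ)).Finite :=
  (Set.finite_univ.prod (Set.finite_Ioo _ _)).subset fun _ hx => ⟨trivial, hx⟩

section slab

variable {d N : ℕ} {η : ℕ} {ζ : ℤ}

theorem cylStep_snd_mem (p : Fin (d + 1) × Bool) :
    -1 ≤ (cylStep d N p).2 ∧ (cylStep d N p).2 ≤ 1 := by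
  obtain ⟨j, b⟩ := p
  induction j using Fin.lastCases with
  | last => rw [cylStep_last]; cases b <;> simp
  | cast j => rw [cylStep_castSucc]; simp

theorem snd_add_cylStep_of_notMem {x : Cyl d N} (hx : x ∈ block d N (bigInterval η ζ))
    {p : Fin (d + 1) × Bool} (hp : x + cylStep d N p ∉ block d N (bigInterval η ζ)) :
    (x + cylStep d N p).2 = ζ + η ∨ (x + cylStep d N p).2 = ζ - η := by
  have hstep := cylStep_snd_mem (N := N) p
  have hx' : ζ - η < x.2 ∧ x.2 < ζ + η := hx
  have hp' : ¬ (ζ - η < (x + cylStep d N p).2 ∧ (x + cylStep d N p).2 < ζ + η) := hp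
  have hadd : (x + cylStep d N p).2 = x.2 + (cylStep d N p).2 := rfl
  omega

variable [NeZero N] {R : Set (Cyl d N)} {σ : ℤ} {x : Cyl d N}

/-- Gambler's ruin for the vertical component of the walk. -/
theorem reachProb_level (hη : 0 < η) (hR : block d N (bigInterval η ζ) ⊆ R)
    (hout : ∀ y : Cyl d N, y.2 = ζ + η ∨ y.2 = ζ - η → y ∉ R) (hσ : σ = 1 ∨ σ = -1)
    (hx : x ∈ block d N (bigInterval η ζ)) :
    reachProb (cylStep d N) R {y | y ∉ R ∧ y.2 = ζ + σ * η} x =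
      (1 + σ * (x.2 - ζ) / η) / 2 := by
  have haffine : ∀ y : Cyl d N, (1 + (σ : ℝ) * (y.2 - ζ) / η) / 2 =
      (1 / 2 - σ * ζ / (2 * η)) + σ / (2 * η) * y.2 := fun y => by
    field_simp
    ring
  have hη' : (η : ℝ) ≠ 0 := by positivity
  simp only [haffine]
  refine eqOn_of_sub_stepAvg_eq
    (g := fun y : Cyl d N => (1 / 2 - (σ : ℝ) * ζ / (2 * η)) + σ / (2 * η) * y.2)
    (exists_not_isOfFinAddOrder_cylStep d N) (finite_block η ζ)
    (fun y hy p hp => ?_) (fun y hy => .inr ?_) hx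
  · have hlevel := snd_add_cylStep_of_notMem hy hp
    generalize y + cylStep d N p = y' at hlevel
    by_cases htarget : y'.2 = ζ + σ * η
    · rw [reachProb_of_mem (Set.mem_ofPred_eq ▸ ⟨hout y' hlevel, htarget⟩), ← haffine, htarget]
      rcases hσ with rfl | rfl <;> push_cast <;> field_simp <;> ring
    · have hopposite : y'.2 = ζ - σ * η := by rcases hσ with rfl | rfl <;> omega
      rw [reachProb_of_notMem (hout y' hlevel) fun h => htarget h.2, ← haffine, hopposite]
      rcases hσ with rfl | rfl <;> push_cast <;> field_simp <;> norm_num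
  · rw [stepAvg_height, ← reachProb_eq_stepAvg (hR hy) fun h => h.1 (hR hy), sub_self, sub_self]

theorem reachProb_level_mem_Icc {δ : ℕ} (hδ : δ < η) (hR : block d N (bigInterval η ζ) ⊆ R)
    (hout : ∀ y : Cyl d N, y.2 = ζ + η ∨ y.2 = ζ - η → y ∉ R) (hσ : σ = 1 ∨ σ = -1)
    (hx : x.2 ∈ smallInterval δ ζ) :
    reachProb (cylStep d N) R {y | y ∉ R ∧ y.2 = ζ + σ * η} x ∈
      Set.Icc ((1 - (δ : ℝ) / η) / 2) ((1 + (δ : ℝ) / η) / 2) := by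
  have hη : (0 : ℝ) < η := by exact_mod_cast hδ.pos
  have hlow : (ζ : ℝ) - δ ≤ x.2 := by exact_mod_cast hx.1
  have hhigh : (x.2 : ℝ) ≤ ζ + δ := by exact_mod_cast hx.2
  have hratio : -((δ : ℝ) / η) ≤ σ * ((x.2 : ℝ) - ζ) / η ∧ σ * ((x.2 : ℝ) - ζ) / η ≤ δ / η := by
    rw [← neg_div]
    rcases hσ with rfl | rfl <;> push_cast <;> constructor <;>
      exact div_le_div_of_nonneg_right (by linarith) hη.le
  rw [reachProb_level hδ.pos hR hout hσ (smallInterval_subset_bigInterval hδ ζ hx)]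
  constructor <;> linarith [hratio.1, hratio.2]

end slab

/-! ### The vertical Green function -/

/-- The steps of simple random walk on `ℤ`. -/
def intStep (b : Bool) : ℤ := if b then 1 else -1

theorem stepAvg_intStep (f : ℤ → ℝ) (z : ℤ) :
    stepAvg intStep f z = (f (z + 1) + f (z - 1)) / 2 := by
  rw [stepAvg, Fintype.expect_eq_sum_div_card, Fintype.sum_bool, Fintype.card_bool]
  rfl

/-- The Green function of simple random walk on `ℤ` killed outside `ζ + (-η, η)`. -/
noncomputable def intervalGreen (η : ℕ) (ζ a z : ℤ) : ℝ :=
  ((η : ℝ) + (min a z : ℤ) - ζ) * (η + ζ - (max a z : ℤ)) / η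

theorem intervalGreen_sub_stepAvg {η : ℕ} (hη : 0 < η) (ζ a z : ℤ) :
    intervalGreen η ζ a z - stepAvg intStep (intervalGreen η ζ a) z = if z = a then 1 else 0 := by
  have hη' : (η : ℝ) ≠ 0 := by positivity
  rw [stepAvg_intStep]
  unfold intervalGreen
  rcases lt_trichotomy z a with h | rfl | h
  · rw [if_neg h.ne, min_eq_right h.le, max_eq_left h.le, min_eq_right (by omega : z + 1 ≤ a),
      max_eq_left (by omega : z + 1 ≤ a), min_eq_right (by omega : z - 1 ≤ a),
      max_eq_left (by omega : z - 1 ≤ a)]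
    push_cast
    field_simp
    ring
  · rw [if_pos rfl, min_self, max_self, min_eq_left (by omega : z ≤ z + 1),
      max_eq_right (by omega : z ≤ z + 1), min_eq_right (by omega : z - 1 ≤ z),
      max_eq_left (by omega : z - 1 ≤ z)]
    push_cast
    field_simp
    ring
  · rw [if_neg h.ne', min_eq_left h.le, max_eq_right h.le, min_eq_left (by omega : a ≤ z + 1),
      max_eq_right (by omega : a ≤ z + 1), min_eq_left (by omega : a ≤ z - 1),
      max_eq_right (by omega : a ≤ z - 1)]
    push_cast
    field_simp
    ring

theorem intervalGreen_eq_zero {η : ℕ} {ζ a z : ℤ} (ha : a ∈ bigInterval η ζ)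
    (hz : z = ζ + η ∨ z = ζ - η) : intervalGreen η ζ a z = 0 := by
  obtain ⟨h1, h2⟩ := ha
  unfold intervalGreen
  rcases hz with rfl | rfl
  · rw [max_eq_right h2.le]
    push_cast
    ring
  · rw [min_eq_right h1.le]
    push_cast
    ring

theorem intervalGreen_mem_Icc {η δ : ℕ} (hδ : δ < η) {ζ a z : ℤ} (ha : a ∈ smallInterval δ ζ)
    (hz : z ∈ smallInterval δ ζ) :
    intervalGreen η ζ a z ∈
      Set.Icc (η * (1 - (δ : ℝ) / η) ^ 2) (η * (1 + (δ : ℝ) / η) ^ 2) := by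
  have hη : (0 : ℝ) < η := by exact_mod_cast hδ.pos
  have hδ' : (δ : ℝ) < η := by exact_mod_cast hδ
  have hmin : (ζ : ℝ) - δ ≤ (min a z : ℤ) := by exact_mod_cast le_min ha.1 hz.1
  have hmin' : ((min a z : ℤ) : ℝ) ≤ ζ + δ := by exact_mod_cast (min_le_left a z).trans ha.2
  have hmax : ((max a z : ℤ) : ℝ) ≤ ζ + δ := by exact_mod_cast max_le ha.2 hz.2
  have hmax' : (ζ : ℝ) - δ ≤ (max a z : ℤ) := by exact_mod_cast ha.1.trans (le_max_left a z)
  have hlow : η * (1 - (δ : ℝ) / η) ^ 2 = ((η : ℝ) - δ) * (η - δ) / η := by field_simp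
  have hhigh : η * (1 + (δ : ℝ) / η) ^ 2 = ((η : ℝ) + δ) * (η + δ) / η := by field_simp
  rw [hlow, hhigh]
  unfold intervalGreen
  constructor <;> gcongr ?_ / _ <;>
    exact mul_le_mul (by linarith) (by linarith) (by linarith) (by linarith)

/-! ### Hitting probabilities from a uniform level -/

theorem cylCap_nonneg {d N : ℕ} {B : Set (Cyl d N)} {C : Finset (Cyl d N)} : 0 ≤ cylCap B C :=
  Finset.sum_nonneg fun _ _ => measureReal_nonneg

theorem cylCap_eq_sum {d N : ℕ} {B : Set (Cyl d N)} {C : Finset (Cyl d N)} (hB : B.Finite)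
    (hC : (C : Set (Cyl d N)) ⊆ B) :
    cylCap B C = ∑ x ∈ C, (1 - stepAvg (cylStep d N) (reachProb (cylStep d N) B C) x) :=
  Finset.sum_congr rfl fun _ hx =>
    walkLaw_real_exitTime_lt_hitTime (exists_not_isOfFinAddOrder_cylStep d N) hB hC (hC hx)

section level

variable {d N : ℕ} [NeZero N] {η : ℕ} {ζ : ℤ}

theorem sum_level_shift (f : Cyl d N → ℝ) (t : Torus d N) (z : ℤ) :
    ∑ y, f (y + t, z) = ∑ y, f (y, z) :=
  Equiv.sum_comp (Equiv.addRight t) fun y => f (y, z)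

/-- Summation over a level turns the walk on the cylinder into the walk on `ℤ`. -/
theorem sum_level_sub_stepAvg (f : Cyl d N → ℝ) (z : ℤ) :
    ∑ y, f (y, z) - stepAvg intStep (fun z => ∑ y, f (y, z)) z =
      (d + 1) * ∑ y : Torus d N, (f (y, z) - stepAvg (cylStep d N) f (y, z)) := by
  have hdir : ∀ c : ZMod N, ∑ y : Torus d N, ∑ j : Fin d, f (y + Pi.single j c, z) =
      d * ∑ y, f (y, z) := fun c => by
    rw [Finset.sum_comm]
    simp only [sum_level_shift, Finset.sum_const, Finset.card_univ, Fintype.card_fin,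
      nsmul_eq_mul]
  have hsum : ∑ y : Torus d N, ∑ p, f ((y, z) + cylStep d N p) =
      2 * d * ∑ y, f (y, z) + (∑ y, f (y, z + 1) + ∑ y, f (y, z - 1)) := by
    simp only [sum_cylStep, Finset.sum_add_distrib, hdir]
    ring
  simp only [stepAvg_intStep, stepAvg_eq_sum_div, Finset.sum_sub_distrib, ← Finset.sum_div, hsum]
  field_simp
  ring

theorem sum_level_of_support (C : Finset (Cyl d N)) (e : Cyl d N → ℝ) (z : ℤ)
    (he : ∀ y, (y, z) ∉ C → e (y, z) = 0) :
    ∑ y, e (y, z) = ∑ x ∈ C, e x * if z = x.2 then 1 else 0 := by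
  classical
  have hpoint : ∀ y : Torus d N, e (y, z) = ∑ x ∈ C, if x = (y, z) then e x else 0 := fun y => by
    rw [Finset.sum_ite_eq']
    split_ifs with h
    exacts [rfl, he y h]
  simp only [hpoint]
  rw [Finset.sum_comm]
  refine Finset.sum_congr rfl fun x _ => ?_
  obtain ⟨y', z'⟩ := x
  rcases eq_or_ne z z' with rfl | h
  · simp
  · simp [h, h.symm]

theorem sum_level_eq_sum_intervalGreen (C : Finset (Cyl d N)) {f : Cyl d N → ℝ}
    (hC : (C : Set (Cyl d N)) ⊆ block d N (bigInterval η ζ))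
    (hoff : ∀ x ∉ block d N (bigInterval η ζ), f x = 0)
    (hharm : ∀ x ∈ block d N (bigInterval η ζ), x ∉ C → f x = stepAvg (cylStep d N) f x)
    {z : ℤ} (hz : z ∈ bigInterval η ζ) :
    ∑ y, f (y, z) =
      (d + 1) * ∑ x ∈ C, (f x - stepAvg (cylStep d N) f x) * intervalGreen η ζ x.2 z := by
  have hη : 0 < η := by have := hz.1.trans hz.2; omega
  have hstep : ∃ b, ¬ IsOfFinAddOrder (intStep b) := ⟨true, by
    rw [← injective_nsmul_iff_not_isOfFinAddOrder]
    intro m n h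
    simpa [intStep] using h⟩
  refine eqOn_of_sub_stepAvg_eq (f := fun z => ∑ y, f (y, z)) (g := fun z =>
    (d + 1) * ∑ x ∈ C, (f x - stepAvg (cylStep d N) f x) * intervalGreen η ζ x.2 z)
    hstep (Set.finite_Ioo _ _) (fun a ha b hb => ?_) (fun a ha => .inr ?_) hz
  · have hlevel : a + intStep b = ζ + η ∨ a + intStep b = ζ - η := by
      have ha' : ζ - η < a ∧ a < ζ + η := ha
      have hb' : ¬ (ζ - η < a + intStep b ∧ a + intStep b < ζ + η) := hb
      cases b <;> simp only [intStep, Bool.false_eq_true, if_false, if_true] at hb' ⊢ <;> omega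
    rw [Finset.sum_eq_zero fun y _ => hoff (y, a + intStep b) hb, Finset.sum_eq_zero fun x hx => ?_,
      mul_zero]
    rw [intervalGreen_eq_zero (hC hx) hlevel, mul_zero]
  · rw [sum_level_sub_stepAvg, stepAvg_const_mul, stepAvg_intStep, ← mul_sub,
      sum_level_of_support C (fun x => f x - stepAvg (cylStep d N) f x) a
        fun y hy => sub_eq_zero.2 (hharm _ ha hy), ← Finset.sum_add_distrib, Finset.sum_div,
      ← Finset.sum_sub_distrib]
    refine congrArg _ (Finset.sum_congr rfl fun x _ => ?_)
    rw [← intervalGreen_sub_stepAvg hη ζ, stepAvg_intStep]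
    ring

theorem sum_level_reachProb (C : Finset (Cyl d N))
    (hC : (C : Set (Cyl d N)) ⊆ block d N (bigInterval η ζ)) {z : ℤ} (hz : z ∈ bigInterval η ζ) :
    ∑ y, reachProb (cylStep d N) (block d N (bigInterval η ζ)) C (y, z) =
      (d + 1) * ∑ x ∈ C, (cylLaw d N x).real {w | exitTime (block d N (bigInterval η ζ)) w <
        hitTime (C : Set (Cyl d N)) w} * intervalGreen η ζ x.2 z := by
  rw [sum_level_eq_sum_intervalGreen C hC
    (fun x hx => reachProb_of_notMem hx fun h => hx (hC h))
    (fun x hx hxC => reachProb_eq_stepAvg hx hxC) hz]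
  refine congrArg _ (Finset.sum_congr rfl fun x hx => ?_)
  rw [reachProb_of_mem (s := cylStep d N) hx, cylLaw, walkLaw_real_exitTime_lt_hitTime
    (exists_not_isOfFinAddOrder_cylStep d N) (finite_block η ζ) hC (hC hx)]

theorem sum_level_reachProb_mem_Icc {δ : ℕ} (hδ : δ < η) (C : Finset (Cyl d N))
    (hC : (C : Set (Cyl d N)) ⊆ block d N (smallInterval δ ζ))
    {z : ℤ} (hz : z ∈ smallInterval δ ζ) :
    ∑ y, reachProb (cylStep d N) (block d N (bigInterval η ζ)) C (y, z) ∈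
      Set.Icc ((1 - (δ : ℝ) / η) ^ 2 * ((d + 1) * η * cylCap (block d N (bigInterval η ζ)) C))
        ((1 + (δ : ℝ) / η) ^ 2 * ((d + 1) * η * cylCap (block d N (bigInterval η ζ)) C)) := by
  have hsub := smallInterval_subset_bigInterval hδ ζ
  have hconst : ∀ a : ℝ, a * ((d + 1) * η * cylCap (block d N (bigInterval η ζ)) C) =
      (d + 1) * ∑ x ∈ C, (cylLaw d N x).real {w | exitTime (block d N (bigInterval η ζ)) w <
        hitTime (C : Set (Cyl d N)) w} * (η * a) := fun a => by
    rw [cylCap, ← Finset.sum_mul]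
    ring
  rw [sum_level_reachProb C (fun x hx => hsub (hC hx)) (hsub hz), hconst, hconst]
  constructor <;> gcongr with x hx
  exacts [(intervalGreen_mem_Icc hδ (hC hx) hz).1, (intervalGreen_mem_Icc hδ (hC hx) hz).2]

end level

/-! ### The excursion law -/

theorem levelLaw_ae_zero {d N : ℕ} [NeZero N] (z : ℤ) :
    ∀ᵐ w ∂(levelLaw d N z), (w 0).2 = z := by
  refine Measure.ae_smul_measure (Measure.ae_sum_iff.2 fun y => ?_) _
  filter_upwards [ae_walkLaw_zero (cylStep d N) (y, z)] with w hw
  rw [hw]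

theorem levelLaw_real {d N : ℕ} [NeZero N] (z : ℤ) {A : Set (ℕ → Cyl d N)}
    (hA : MeasurableSet A) :
    (levelLaw d N z).real A = (∑ y, (walkLaw (cylStep d N) (y, z)).real A) / (N : ℝ) ^ d := by
  have : ∀ y : Torus d N, IsProbabilityMeasure (cylLaw d N (y, z)) := fun y => by
    unfold cylLaw; infer_instance
  rw [measureReal_def, levelLaw, Measure.smul_apply, Measure.sum_apply _ hA, tsum_fintype,
    smul_eq_mul, ENNReal.toReal_mul, ENNReal.toReal_sum fun y _ => measure_ne_top _ _]
  simp [measureReal_def, div_eq_inv_mul, cylLaw]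

section grid

variable {d N L : ℕ} {δ η : ℕ} (ζ : Fin L → ℤ) (l : Fin L)

theorem block_subset_departureRegion :
    block d N (bigInterval η (ζ l)) ⊆ departureRegion d N η ζ := fun _ hx =>
  Set.mem_iUnion₂.2 ⟨ζ l, .inl ⟨l, rfl⟩, hx⟩

theorem notMem_departureRegion (hsep : ∀ m, m ≠ l → 2 * (η : ℤ) ≤ |ζ m - ζ l|) {x : Cyl d N}
    (hx : x.2 = ζ l + η ∨ x.2 = ζ l - η) : x ∉ departureRegion d N η ζ := by
  intro h
  obtain ⟨g, hg, hlower, hupper⟩ := Set.mem_iUnion₂.1 h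
  have hgl : g = ζ l ∨ 2 * (η : ℤ) ≤ |g - ζ l| := by
    rcases hg with ⟨m, rfl⟩ | ⟨_, hg⟩
    · exact or_iff_not_imp_left.2 fun hm => hsep m fun h => hm (congrArg ζ h)
    · exact .inr (hg l)
  rcases hgl with rfl | hgl
  · omega
  · rcases le_abs.1 hgl with hfar | hfar <;> omega

theorem firstDeparture_eq_exitTime {w : ℕ → Cyl d N} (hw : (w 0).2 ∈ smallInterval δ (ζ l)) :
    firstDeparture d N δ η ζ w = exitTime (departureRegion d N η ζ) w := by
  have h0 : firstReturn d N δ η ζ w = ((0 : ℕ) : WithTop ℕ) :=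
    (hittingAfter_eq_coe_iff 0 0).2
      ⟨⟨le_rfl, Set.mem_iUnion₂.2 ⟨ζ l, .inl ⟨l, rfl⟩, hw⟩⟩, fun m _ hm => absurd hm m.not_lt_zero⟩
  unfold firstDeparture
  rw [h0]
  simp

theorem exists_exitTime_eq_iff {S : Type*} {R A : Set S} {w : ℕ → S} :
    (∃ n : ℕ, exitTime R w = (n : WithTop ℕ) ∧ w n ∈ A) ↔ w ∈ reach R (Rᶜ ∩ A) := by
  refine exists_congr fun n => ?_
  have hcoe : exitTime R w = (n : WithTop ℕ) ↔ _ := hittingAfter_eq_coe_iff 0 n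
  simp only [hcoe, zero_le, true_and, true_implies, Set.mem_compl_iff, not_not, Set.mem_inter_iff]
  tauto

theorem excursionLaw_real [NeZero N] {z z' : ℤ} (hz : z ∈ smallInterval δ (ζ l))
    {B C : Set (Cyl d N)} (hCB : C ⊆ B) :
    (excursionLaw d N δ η ζ z z').real {X | entranceTime C X < exitTime B X} =
      (∑ y, (walkLaw (cylStep d N) (y, z)).real (reach B C ∩
          reach (departureRegion d N η ζ) {x | x ∉ departureRegion d N η ζ ∧ x.2 = z'})) /
        ∑ y, reachProb (cylStep d N) (departureRegion d N η ζ)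
          {x | x ∉ departureRegion d N η ζ ∧ x.2 = z'} (y, z) := by
  have hN : (N : ℝ) ^ d ≠ 0 := pow_ne_zero _ (Nat.cast_ne_zero.2 (NeZero.ne N))
  set R := departureRegion d N η ζ
  have hT : {X : ℕ → Cyl d N | entranceTime C X < exitTime B X} = reach B C :=
    Set.ext fun X => entranceTime_lt_exitTime_iff hCB
  have hE : {w : ℕ → Cyl d N | ∃ n : ℕ, firstDeparture d N δ η ζ w = (n : WithTop ℕ) ∧
      (w n).2 = z'} =ᵐ[levelLaw d N z] reach R {x | x ∉ R ∧ x.2 = z'} := by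
    filter_upwards [levelLaw_ae_zero (d := d) z] with w hw
    refine propext (Iff.trans ?_ (exists_exitTime_eq_iff (A := {x : Cyl d N | x.2 = z'})))
    change (∃ n : ℕ, firstDeparture d N δ η ζ w = n ∧ _) ↔ _
    rw [firstDeparture_eq_exitTime ζ l (hw ▸ hz)]
    rfl
  have hE' := measure_congr (hE.inter (ae_eq_refl (reach B C)))
  have hR := measurableSet_reach R {x | x ∉ R ∧ x.2 = z'}
  have hBC := measurableSet_reach B C
  rw [hT, measureReal_def, excursionLaw, cond_apply' hBC, measure_congr hE, hE',
    ENNReal.toReal_mul, ENNReal.toReal_inv,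
    Set.inter_comm, ← measureReal_def, ← measureReal_def, levelLaw_real z hR,
    levelLaw_real z (hBC.inter hR), inv_div, div_mul_div_comm, mul_comm, mul_div_mul_right _ _ hN]
  rfl

end grid

theorem abs_div_sub_div_le {ε D Q U V W : ℝ} (hε₀ : 0 ≤ ε) (hε : ε ≤ 1 / 2) (hD : 0 < D)
    (hW : 0 ≤ W) (hQ : Q ∈ Set.Icc (D * ((1 - ε) / 2)) (D * ((1 + ε) / 2)))
    (hU : U ∈ Set.Icc ((1 - ε) / 2 * V) ((1 + ε) / 2 * V))
    (hV : V ∈ Set.Icc ((1 - ε) ^ 2 * W) ((1 + ε) ^ 2 * W)) :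
    |U / Q - W / D| ≤ 20 * ε * (W / D) := by
  have hQ₀ : 0 < Q := (mul_pos hD (by linarith)).trans_le hQ.1
  have hlow : (1 - ε) ^ 3 / 2 * W ≤ U := by nlinarith [hU.1, hV.1]
  have hhigh : U ≤ (1 + ε) ^ 3 / 2 * W := by nlinarith [hU.2, hV.2]
  have hε' : 0 ≤ 1 / 2 - ε := sub_nonneg.2 hε
  have : 0 ≤ W * D := mul_nonneg hW hD.le
  have hlow' : W * Q - U * D ≤ 20 * ε * W * Q :=
    calc W * Q - U * D ≤ W * (D * ((1 + ε) / 2)) - (1 - ε) ^ 3 / 2 * W * D := by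
          gcongr; exact hQ.2
      _ = W * D * ((1 + ε - (1 - ε) ^ 3) / 2) := by ring
      _ ≤ W * D * (20 * ε * ((1 - ε) / 2)) := by
          gcongr W * D * ?_
          nlinarith [mul_nonneg hε₀ hε', mul_nonneg (sq_nonneg ε) hε']
      _ = 20 * ε * W * (D * ((1 - ε) / 2)) := by ring
      _ ≤ 20 * ε * W * Q := by gcongr; exact hQ.1
  have hhigh' : U * D - W * Q ≤ 20 * ε * W * Q :=
    calc U * D - W * Q ≤ (1 + ε) ^ 3 / 2 * W * D - W * (D * ((1 - ε) / 2)) := by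
          gcongr; exact hQ.1
      _ = W * D * (((1 + ε) ^ 3 - (1 - ε)) / 2) := by ring
      _ ≤ W * D * (20 * ε * ((1 - ε) / 2)) := by
          gcongr W * D * ?_
          nlinarith [mul_nonneg hε₀ hε', mul_nonneg (sq_nonneg ε) hε']
      _ = 20 * ε * W * (D * ((1 - ε) / 2)) := by ring
      _ ≤ 20 * ε * W * Q := by gcongr; exact hQ.1
  rw [div_sub_div _ _ hQ₀.ne' hD.ne', abs_div, abs_of_pos (mul_pos hQ₀ hD),
    div_le_iff₀ (mul_pos hQ₀ hD), abs_le]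
  have : 20 * ε * (W / D) * (Q * D) = 20 * ε * W * Q := by field_simp
  constructor <;> linarith

theorem exists_eq_mul_one_add {P κ ε : ℝ} (hκ : 0 ≤ κ) (hε : 0 ≤ ε) (h : |P - κ| ≤ ε * κ) :
    ∃ Ψ : ℝ, |Ψ| ≤ ε ∧ P = κ * (1 + Ψ) := by
  rcases hκ.eq_or_lt with rfl | hκ
  · exact ⟨0, by simpa using hε, by simpa using h⟩
  · refine ⟨(P - κ) / κ, ?_, by field_simp; ring⟩
    rwa [abs_div, abs_of_pos hκ, div_le_iff₀ hκ]

theorem excursionLaw_real_eq_mul_one_add {d N L : ℕ} [NeZero N] {δ η : ℕ} {ζ : Fin L → ℤ}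
    {l : Fin L} (hη : 0 < η) (hδ : 2 * δ ≤ η) (hsep : ∀ m, m ≠ l → 2 * (η : ℤ) ≤ |ζ m - ζ l|)
    {C : Finset (Cyl d N)} (hC : (C : Set (Cyl d N)) ⊆ block d N (smallInterval δ (ζ l)))
    {z₁ z₂ : ℤ} (hz₁ : z₁ ∈ smallInterval δ (ζ l)) (hz₂ : z₂ ∈ bdry (bigInterval η (ζ l))) :
    ∃ Ψ : ℝ, |Ψ| ≤ 20 * ((δ : ℝ) / η) ∧
      (excursionLaw d N δ η ζ z₁ z₂).real
          {X | entranceTime (C : Set (Cyl d N)) X < exitTime (block d N (bigInterval η (ζ l))) X} =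
        ((d : ℝ) + 1) * ((η : ℝ) / (N : ℝ) ^ d) *
          cylCap (block d N (bigInterval η (ζ l))) C * (1 + Ψ) := by
  obtain ⟨σ, hσ, rfl⟩ := mem_bdry_bigInterval hz₂
  have hδη : δ < η := by omega
  have hε : (δ : ℝ) / η ≤ 1 / 2 := by
    rw [div_le_div_iff₀ (by exact_mod_cast hη) two_pos]
    exact_mod_cast (by omega : δ * 2 ≤ 1 * η)
  have hN : (0 : ℝ) < (N : ℝ) ^ d := pow_pos (Nat.cast_pos.2 (NeZero.pos N)) _
  have hsub := smallInterval_subset_bigInterval hδη (ζ l)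
  have hCB : (C : Set (Cyl d N)) ⊆ block d N (bigInterval η (ζ l)) := fun x hx => hsub (hC hx)
  have hR := block_subset_departureRegion (d := d) (N := N) (η := η) ζ l
  set B := block d N (bigInterval η (ζ l))
  set R := departureRegion d N η ζ
  set A := {x : Cyl d N | x ∉ R ∧ x.2 = ζ l + σ * η}
  have hAB : Disjoint B A := Set.disjoint_left.2 fun x hxB hxA => hxA.1 (hR hxB)
  have hexit := fun (x : Cyl d N) (hx : x.2 ∈ smallInterval δ (ζ l)) =>
    reachProb_level_mem_Icc hδη hR (fun y => notMem_departureRegion ζ l hsep) hσ hx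
  have hs := exists_not_isOfFinAddOrder_cylStep d N
  have hbound := abs_div_sub_div_le (D := (N : ℝ) ^ d)
    (W := (d + 1) * η * cylCap B C) (by positivity) hε hN
    (mul_nonneg (by positivity) cylCap_nonneg)
    (Q := ∑ y, reachProb (cylStep d N) R A (y, z₁))
    (U := ∑ y, (walkLaw (cylStep d N) (y, z₁)).real (reach B C ∩ reach R A))
    ?_ ?_ (sum_level_reachProb_mem_Icc hδη C hC hz₁)
  · rw [excursionLaw_real ζ l hz₁ hCB]
    refine exists_eq_mul_one_add (mul_nonneg (by positivity) cylCap_nonneg) (by positivity) ?_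
    rwa [show (d + 1 : ℝ) * (η / (N : ℝ) ^ d) * cylCap B C =
      (d + 1) * η * cylCap B C / (N : ℝ) ^ d by ring]
  · have hcard : ∀ a : ℝ, (N : ℝ) ^ d * a = ∑ _y : Torus d N, a := fun a => by simp
    rw [hcard, hcard]
    exact ⟨Finset.sum_le_sum fun y _ => (hexit (y, z₁) hz₁).1,
      Finset.sum_le_sum fun y _ => (hexit (y, z₁) hz₁).2⟩
  · rw [Finset.mul_sum, Finset.mul_sum]
    exact ⟨Finset.sum_le_sum fun y _ => mul_reachProb_le_inter hs (finite_block η _) hCB hR hAB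
        (fun x hx => (hexit x (hC hx)).1) (hsub hz₁),
      Finset.sum_le_sum fun y _ => inter_le_mul_reachProb hs (finite_block η _) hCB hR hAB
        (fun x hx => (hexit x (hC hx)).2) (hsub hz₁)⟩

/-! ### Superharmonicity of negative powers -/

theorem choose_succ_eq_mul_div (a : ℝ) (n : ℕ) :
    Ring.choose a (n + 1) = Ring.choose a n * (a - n) / (n + 1) := by
  simp only [Ring.choose_eq_smul, descPochhammer_succ_right, Polynomial.smeval_mul,
    Polynomial.smeval_sub, Polynomial.smeval_X, Polynomial.smeval_natCast, Nat.factorial_succ,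
    smul_eq_mul, pow_one, pow_zero, nsmul_eq_mul, mul_one]
  push_cast
  field_simp

theorem exists_one_add_rpow_le_cubic (a : ℝ) : ∃ r > 0, ∃ C ≥ 0, ∀ t : ℝ, |t| ≤ r →
    (1 + t) ^ a ≤ 1 + a * t + a * (a - 1) / 2 * t ^ 2 + a * (a - 1) * (a - 2) / 6 * t ^ 3 +
      C * t ^ 4 := by
  obtain ⟨C, hC, h⟩ :=
    ((Real.one_add_rpow_hasFPowerSeriesAt_zero (a := a)).isBigO_sub_partialSum_pow 4).exists_nonneg
  rw [IsBigOWith, Metric.eventually_nhds_iff] at h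
  obtain ⟨r, hr, h⟩ := h
  refine ⟨r / 2, by positivity, C, hC, fun t ht => ?_⟩
  have hsum : (binomialSeries ℝ a).partialSum 4 t = 1 + a * t + a * (a - 1) / 2 * t ^ 2 +
      a * (a - 1) * (a - 2) / 6 * t ^ 3 := by
    simp [FormalMultilinearSeries.partialSum, Finset.sum_range_succ, binomialSeries,
      FormalMultilinearSeries.ofScalars, choose_succ_eq_mul_div a 1, choose_succ_eq_mul_div a 2]
    ring
  have hbound := h (y := t) (by rw [Real.dist_eq, sub_zero]; linarith)
  rw [hsum, zero_add, norm_pow, norm_norm, Real.norm_eq_abs, Real.norm_eq_abs,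
    Even.pow_abs (by decide)] at hbound
  linarith [(le_abs_self _).trans hbound]

theorem exists_one_add_rpow_neg_add_le {α : ℝ} (hα : 0 ≤ α) : ∃ ρ > 0, ρ < 1 ∧ ∃ e ≥ 0,
    ∀ s t σ η ε : ℝ, ε ≤ ρ → ε ≤ 8 * η → σ ≤ s + t → s ^ 2 + t ^ 2 ≤ ε →
      -3 * η * ε ≤ s ^ 3 + t ^ 3 →
      (1 + s) ^ (-α) + (1 + t) ^ (-α) ≤ 2 - α * σ + (α * (α + 1) / 2 + e * η) * ε := by
  obtain ⟨r, hr, C, hC, hcubic⟩ := exists_one_add_rpow_le_cubic (-α)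
  refine ⟨min (r ^ 2) (1 / 2), by positivity, (min_le_right _ _).trans_lt (by norm_num),
    α * (α + 1) * (α + 2) / 2 + 8 * C, by positivity, fun s t σ η ε hερ hεη hsum hsq hcube => ?_⟩
  have hεr : ε ≤ r ^ 2 := hερ.trans (min_le_left _ _)
  have hs := hcubic s (abs_le_of_sq_le_sq (by linarith [sq_nonneg t]) hr.le)
  have ht := hcubic t (abs_le_of_sq_le_sq (by linarith [sq_nonneg s]) hr.le)
  have hfourth : s ^ 4 + t ^ 4 ≤ 8 * η * ε := by
    have hε : 0 ≤ ε := by linarith [sq_nonneg s, sq_nonneg t]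
    calc s ^ 4 + t ^ 4 ≤ (s ^ 2 + t ^ 2) ^ 2 := by linarith [sq_nonneg (s * t)]
      _ ≤ ε ^ 2 := by gcongr
      _ ≤ 8 * η * ε := by rw [sq]; gcongr
  have hlinear := mul_le_mul_of_nonneg_left hsum hα
  have hquadratic := mul_le_mul_of_nonneg_left hsq (show 0 ≤ α * (α + 1) / 2 by positivity)
  have hthird := mul_le_mul_of_nonneg_left hcube (show 0 ≤ α * (α + 1) * (α + 2) / 6 by positivity)
  have hremainder := mul_le_mul_of_nonneg_left hfourth hC
  linarith

/-- The increments `u` and `v` of a square `q` when the coordinate makes a step `+1` or `-1`: if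
`q = a ^ 2` then `u = 2 * a + 1`, `v = -2 * a + 1` and `b = 0`. The defect `b` leaves room for
squares that are cut off or smoothed at the boundary of a fundamental domain of the torus. -/
structure SquareLikeIncrements (q b u v : ℝ) : Prop where
  two_sub_le_add : 2 - 4 * b ≤ u + v
  sq_add_sq_le : u ^ 2 + v ^ 2 ≤ 8 * q + 2
  le_cube_add_cube : -3 * (8 * q + 2) ≤ u ^ 3 + v ^ 3

theorem exists_rpow_neg_add_le_of_squareLikeIncrements {α : ℝ} (hα : 0 ≤ α) :
    ∃ A ≥ 1, ∃ e ≥ 0, ∀ q b u v Q : ℝ, 0 ≤ q → A + q ≤ Q → SquareLikeIncrements q b u v →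
      (Q + u) ^ (-α) + (Q + v) ^ (-α) ≤ Q ^ (-α) *
        (2 - α * ((2 - 4 * b) / Q) + (α * (α + 1) / 2 + e / Q) * ((8 * q + 2) / Q ^ 2)) := by
  obtain ⟨ρ, hρ, hρ1, e, he, hpair⟩ := exists_one_add_rpow_neg_add_le hα
  refine ⟨8 / ρ, by rw [ge_iff_le, one_le_div hρ]; linarith, e, he, fun q b u v Q hq hQ h => ?_⟩
  have hAQ : 8 / ρ ≤ Q := by linarith
  have hA : 1 ≤ 8 / ρ := by rw [one_le_div hρ]; linarith
  have hQ0 : 0 < Q := by linarith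
  have hε : (8 * q + 2) / Q ^ 2 ≤ 8 * (1 / Q) := by
    rw [div_le_iff₀ (by positivity)]
    calc 8 * q + 2 ≤ 8 * Q := by linarith
      _ = 8 * (1 / Q) * Q ^ 2 := by field_simp
  have hερ : (8 * q + 2) / Q ^ 2 ≤ ρ := by
    refine hε.trans ?_
    rw [mul_one_div, div_le_iff₀ hQ0, mul_comm]
    rwa [div_le_iff₀ hρ] at hAQ
  have h2 : (u / Q) ^ 2 + (v / Q) ^ 2 ≤ (8 * q + 2) / Q ^ 2 := by
    rw [div_pow, div_pow, ← add_div]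
    exact div_le_div_of_nonneg_right h.sq_add_sq_le (by positivity)
  have hfactor : ∀ x : ℝ, (x / Q) ^ 2 ≤ ρ → (Q + x) ^ (-α) = Q ^ (-α) * (1 + x / Q) ^ (-α) := by
    intro x hx
    have hx1 := abs_le_of_sq_le_sq' (show (x / Q) ^ 2 ≤ 1 ^ 2 by linarith) zero_le_one
    rw [← Real.mul_rpow hQ0.le (by linarith [hx1.1]), mul_add, mul_one, mul_div_cancel₀ _ hQ0.ne']
  rw [hfactor u (by linarith [sq_nonneg (v / Q)]), hfactor v (by linarith [sq_nonneg (u / Q)]),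
    ← mul_add, div_eq_mul_one_div e Q]
  refine mul_le_mul_of_nonneg_left (hpair _ _ _ _ _ hερ hε ?_ h2 ?_) (Real.rpow_nonneg hQ0.le _)
  · rw [← add_div]
    gcongr
    exact h.two_sub_le_add
  · calc -3 * (1 / Q) * ((8 * q + 2) / Q ^ 2) = -3 * (8 * q + 2) / Q ^ 3 := by field_simp
      _ ≤ (u ^ 3 + v ^ 3) / Q ^ 3 := by gcongr; exact h.le_cube_add_cube
      _ = (u / Q) ^ 3 + (v / Q) ^ 3 := by rw [div_pow, div_pow, add_div]

theorem second_order_coefficient_le {α e A Q : ℝ} (hα : 1 / 2 ≤ α) (he : 0 ≤ e)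
    (hA : α + 1 + 3 * e ≤ A) (hQ : 0 < Q) :
    (α * (α + 1) / 2 + e / Q) * (8 * (Q - A) + 4 * (α + 1)) ≤ 4 * α * (α + 1) * Q := by
  have hα' : 3 / 8 ≤ α * (α + 1) / 2 := by nlinarith
  have hgain : 8 * e ≤ (α * (α + 1) / 2 + e / Q) * (8 * A - 4 * (α + 1)) :=
    calc 8 * e ≤ 3 / 8 * (8 * A - 4 * (α + 1)) := by linarith
      _ ≤ _ := by
        gcongr
        · linarith
        · linarith [div_nonneg he hQ.le]
  have hcancel : e / Q * Q = e := div_mul_cancel₀ e hQ.ne'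
  linarith

/-- The exponent `card ι / 2 - 1` is the critical one: the gradient term and the Hessian term cancel
to leading order, and a large additive constant `A` absorbs the fourth-order remainder. -/
theorem exists_rpow_neg_superharmonic {ι : Type*} [Fintype ι] {α : ℝ} (hα : 1 / 2 ≤ α)
    (hι : (Fintype.card ι : ℝ) = 2 * (α + 1)) :
    ∃ A : ℝ, 1 ≤ A ∧ ∀ q b u v : ι → ℝ, (∀ j, 0 ≤ q j) →
      (∀ j, SquareLikeIncrements (q j) (b j) (u j) (v j)) →
      ∑ j, ((A + ∑ i, q i + u j) ^ (-α) + (A + ∑ i, q i + v j) ^ (-α)) ≤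
        (A + ∑ i, q i) ^ (-α) *
          (2 * Fintype.card ι + 4 * α * (∑ j, b j) / (A + ∑ i, q i)) := by
  obtain ⟨A₀, hA₀, e, he, hpair⟩ :=
    exists_rpow_neg_add_le_of_squareLikeIncrements (show 0 ≤ α by linarith)
  refine ⟨A₀ + (α + 1) + 3 * e, by linarith, fun q b u v hq h => ?_⟩
  set A := A₀ + (α + 1) + 3 * e
  set Q := A + ∑ j, q j with hQ
  have hqQ : ∀ j, A₀ + q j ≤ Q := fun j => by
    linarith [Finset.single_le_sum (f := q) (fun i _ => hq i) (Finset.mem_univ j)]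
  have hQ0 : 0 < Q := by linarith [Finset.sum_nonneg fun j (_ : j ∈ Finset.univ) => hq j]
  set k := α * (α + 1) / 2 + e / Q
  have hsum : ∑ j, (2 - α * ((2 - 4 * b j) / Q) + k * ((8 * q j + 2) / Q ^ 2)) =
      2 * Fintype.card ι + 4 * α * (∑ j, b j) / Q - 4 * α * (α + 1) / Q +
        k * (8 * (Q - A) + 4 * (α + 1)) / Q ^ 2 := by
    have hq' : ∑ j, q j = Q - A := by rw [hQ]; ring
    simp only [Finset.sum_add_distrib, Finset.sum_sub_distrib, ← Finset.mul_sum, ← Finset.sum_div,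
      Finset.sum_const, Finset.card_univ, nsmul_eq_mul, hq', hι]
    ring
  have hk' : k * (8 * (Q - A) + 4 * (α + 1)) / Q ^ 2 ≤ 4 * α * (α + 1) / Q := by
    rw [div_le_div_iff₀ (by positivity) hQ0, sq, ← mul_assoc]
    refine mul_le_mul_of_nonneg_right ?_ hQ0.le
    exact second_order_coefficient_le hα he (show α + 1 + 3 * e ≤ A by linarith) hQ0
  calc ∑ j, ((Q + u j) ^ (-α) + (Q + v j) ^ (-α))
      ≤ ∑ j, Q ^ (-α) * (2 - α * ((2 - 4 * b j) / Q) + k * ((8 * q j + 2) / Q ^ 2)) :=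
        Finset.sum_le_sum fun j _ => hpair _ _ _ _ _ (hq j) (hqQ j) (h j)
    _ ≤ Q ^ (-α) * (2 * Fintype.card ι + 4 * α * (∑ j, b j) / Q) := by
      rw [← Finset.mul_sum, hsum]
      exact mul_le_mul_of_nonneg_left (by linarith) (Real.rpow_nonneg hQ0.le _)

theorem sqrt_second_difference {m z : ℝ} (hm : 1 ≤ m) :
    2 * √(m ^ 2 + z ^ 2) + m ^ 2 / (4 * √(m ^ 2 + z ^ 2) ^ 3) ≤
      √(m ^ 2 + (z + 1) ^ 2) + √(m ^ 2 + (z - 1) ^ 2) := by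
  set s := √(m ^ 2 + z ^ 2)
  set a := √(m ^ 2 + (z + 1) ^ 2)
  set b := √(m ^ 2 + (z - 1) ^ 2)
  have hs2 : s ^ 2 = m ^ 2 + z ^ 2 := Real.sq_sqrt (by positivity)
  have ha2 : a ^ 2 = m ^ 2 + (z + 1) ^ 2 := Real.sq_sqrt (by positivity)
  have hb2 : b ^ 2 = m ^ 2 + (z - 1) ^ 2 := Real.sq_sqrt (by positivity)
  have hs1 : 1 ≤ s := Real.one_le_sqrt.2 (by nlinarith [sq_nonneg z])
  set k := m ^ 2 / s ^ 2
  have hks : k * s ^ 2 = m ^ 2 := div_mul_cancel₀ _ (by positivity)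
  have hk0 : 0 ≤ k := by positivity
  have hk1 : k ≤ 1 := div_le_one_of_le₀ (by linarith [sq_nonneg z]) (by positivity)
  have hmul : s ^ 2 - 1 + 2 * k ≤ a * b := by
    refine (abs_le_of_sq_le_sq' ?_ (by positivity)).2
    have hab : (a * b) ^ 2 = (s ^ 2 - 1) ^ 2 + 4 * (k * s ^ 2) := by
      rw [mul_pow, ha2, hb2, hks, hs2]
      ring
    rw [hab]
    linarith [mul_le_of_le_one_right hk0 hk1]
  have hquot : m ^ 2 / (4 * s ^ 3) = k / (4 * s) := by
    rw [← hks]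
    field_simp
  rw [hquot]
  refine (abs_le_of_sq_le_sq' ?_ (by positivity)).2
  calc (2 * s + k / (4 * s)) ^ 2 = 4 * s ^ 2 + k + k * (k / (16 * s ^ 2)) := by field_simp; ring
    _ ≤ 4 * s ^ 2 + k + k * 1 := by
      gcongr
      exact div_le_one_of_le₀ (by nlinarith) (by positivity)
    _ ≤ (a + b) ^ 2 := by linarith

/-! ### Truncated squares -/

/-- The function `a ^ 2` on `[-m, m]`, continued with second differences at least `-2` to a function
that is constant outside `[-2 * m, 2 * m]`, so that it can be transported to a circle. -/
def cutSq (m a : ℤ) : ℤ :=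
  if |a| ≤ m then a ^ 2 else if |a| ≤ 2 * m then 2 * m ^ 2 - (2 * m - |a|) ^ 2 else 2 * m ^ 2

theorem cutSq_neg (m a : ℤ) : cutSq m (-a) = cutSq m a := by
  simp [cutSq]

theorem cutSq_of_le {m a : ℤ} (h : |a| ≤ m) : cutSq m a = a ^ 2 := if_pos h

theorem cutSq_of_mid {m a : ℤ} (h1 : m ≤ a) (h2 : a ≤ 2 * m) :
    cutSq m a = 2 * m ^ 2 - (2 * m - a) ^ 2 := by
  have h0 : |a| = a := abs_of_nonneg (by omega)
  unfold cutSq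
  rw [h0, if_pos h2]
  split_ifs with h
  · rw [le_antisymm h h1]
    ring
  · rfl

theorem cutSq_of_ge {m a : ℤ} (hm : 0 ≤ m) (h : 2 * m ≤ |a|) : cutSq m a = 2 * m ^ 2 := by
  unfold cutSq
  split_ifs with h1 h2
  · obtain rfl : m = 0 := by omega
    simp [abs_nonpos_iff.1 h1]
  · rw [le_antisymm h2 h]
    ring
  · rfl

theorem sq_le_cutSq {m a : ℤ} (h : m ≤ |a|) : m ^ 2 ≤ cutSq m a := by
  unfold cutSq
  split_ifs with h1 h2
  · rw [← sq_abs a, le_antisymm h1 h]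
  · have : (2 * m - |a|) ^ 2 ≤ m ^ 2 := pow_le_pow_left₀ (by omega) (by omega) 2
    linarith
  · linarith [sq_nonneg m]

theorem cutSq_nonneg (m a : ℤ) : 0 ≤ cutSq m a := by
  rcases le_total m |a| with h | h
  · exact (sq_nonneg m).trans (sq_le_cutSq h)
  · rw [cutSq_of_le h]
    exact sq_nonneg a

theorem sq_le_sixteen_mul_cutSq {m a : ℤ} (h : |a| ≤ 4 * m) : a ^ 2 ≤ 16 * cutSq m a := by
  rcases le_total m |a| with h1 | h1
  · have h2 : |a| ^ 2 ≤ (4 * m) ^ 2 := pow_le_pow_left₀ (abs_nonneg a) h 2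
    rw [sq_abs] at h2
    linarith [sq_le_cutSq h1]
  · rw [cutSq_of_le h1]
    linarith [sq_nonneg a]

theorem cutSq_add_one_sub {m a : ℤ} (hm : 0 ≤ m) (h : m ≤ a) :
    cutSq m (a + 1) - cutSq m a = max (4 * m - 2 * a - 1) 0 := by
  rcases lt_or_ge a (2 * m) with h' | h'
  · rw [cutSq_of_mid h h'.le, cutSq_of_mid (by omega) (by omega), max_eq_left (by omega)]
    ring
  · rw [cutSq_of_ge hm (le_abs.2 (by omega)), cutSq_of_ge hm (le_abs.2 (by omega)),
      max_eq_right (by omega), sub_self]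

theorem cutSq_sub_one_sub {m a : ℤ} (hm : 1 ≤ m) (h : m ≤ a) :
    m < a ∧ cutSq m (a - 1) - cutSq m a = -max (4 * m - 2 * a + 1) 0 ∨
      a = m ∧ cutSq m (a - 1) - cutSq m a = 1 - 2 * m := by
  rcases h.eq_or_lt with rfl | h
  · refine Or.inr ⟨rfl, ?_⟩
    rw [cutSq_of_le (abs_le.2 (by omega)), cutSq_of_le (abs_le.2 (by omega))]
    ring
  · have := cutSq_add_one_sub (show 0 ≤ m by omega) (show m ≤ a - 1 by omega)
    rw [sub_add_cancel] at this
    exact Or.inl ⟨h, by omega⟩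

theorem SquareLikeIncrements.symm {q b u v : ℝ} (h : SquareLikeIncrements q b u v) :
    SquareLikeIncrements q b v u where
  two_sub_le_add := by linarith [h.two_sub_le_add]
  sq_add_sq_le := by linarith [h.sq_add_sq_le]
  le_cube_add_cube := by linarith [h.le_cube_add_cube]

theorem squareLikeIncrements_sq (a : ℝ) :
    SquareLikeIncrements (a ^ 2) 0 (2 * a + 1) (-2 * a + 1) where
  two_sub_le_add := by linarith
  sq_add_sq_le := by linarith
  le_cube_add_cube := by linarith [sq_nonneg a]

theorem squareLikeIncrements_of_abs_le {m q u v : ℝ} (hu : |u| ≤ 2 * m) (hv : |v| ≤ 2 * m)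
    (huv : -2 ≤ u + v) (hq : m ^ 2 ≤ q) : SquareLikeIncrements q 1 u v := by
  have hu2 : u ^ 2 ≤ (2 * m) ^ 2 := sq_le_sq' (abs_le.1 hu).1 (abs_le.1 hu).2
  have hv2 : v ^ 2 ≤ (2 * m) ^ 2 := sq_le_sq' (abs_le.1 hv).1 (abs_le.1 hv).2
  refine ⟨by linarith, by linarith, ?_⟩
  have h0 : 0 ≤ u ^ 2 - u * v + v ^ 2 := by linarith [sq_nonneg (u - v), sq_nonneg (u + v)]
  calc -3 * (8 * q + 2) ≤ -2 * (u ^ 2 - u * v + v ^ 2) := by linarith [sq_nonneg (u + v)]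
    _ ≤ (u + v) * (u ^ 2 - u * v + v ^ 2) := by gcongr
    _ = u ^ 3 + v ^ 3 := by ring

theorem squareLikeIncrements_cutSq {m : ℤ} (hm : 1 ≤ m) (a : ℤ) :
    SquareLikeIncrements (cutSq m a) (if m ≤ |a| then 1 else 0)
      (cutSq m (a + 1) - cutSq m a) (cutSq m (a - 1) - cutSq m a) := by
  wlog ha : 0 ≤ a generalizing a
  · have h := (this (-a) (by omega)).symm
    rwa [abs_neg, cutSq_neg, show -a + 1 = -(a - 1) by ring, show -a - 1 = -(a + 1) by ring,
      cutSq_neg, cutSq_neg] at h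
  rw [abs_of_nonneg ha]
  split_ifs with h
  · have hadd := cutSq_add_one_sub (by omega) h
    have hsub := cutSq_sub_one_sub hm h
    refine squareLikeIncrements_of_abs_le (m := m) ?_ ?_ ?_
      (mod_cast sq_le_cutSq (h.trans (le_abs_self a)))
    · exact mod_cast abs_le.2 (by omega)
    · exact mod_cast abs_le.2 (by omega)
    · exact mod_cast (show -2 ≤ cutSq m (a + 1) - cutSq m a + (cutSq m (a - 1) - cutSq m a) by
        omega)
  · rw [cutSq_of_le (abs_le.2 (by omega)), cutSq_of_le (abs_le.2 (by omega)),
      cutSq_of_le (abs_le.2 (by omega))]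
    convert squareLikeIncrements_sq a using 1 <;> push_cast <;> ring

theorem two_mul_abs_valMinAbs_le {N : ℕ} [NeZero N] (y : ZMod N) : 2 * |y.valMinAbs| ≤ N := by
  have := y.natAbs_valMinAbs_le
  rw [Int.abs_eq_natAbs]
  omega

theorem cutSq_valMinAbs_intCast {N : ℕ} [NeZero N] {m : ℤ} (hm : 0 ≤ m) (hN : 4 * m + 2 ≤ N) {b : ℤ}
    (hb : 2 * |b| ≤ N + 2) : cutSq m (b : ZMod N).valMinAbs = cutSq m b := by
  obtain ⟨hb1, hb2⟩ := abs_le.1 (show |b| ≤ (N + 2 : ℤ) / 2 by omega)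
  by_cases hin : b * 2 ∈ Set.Ioc (-(N : ℤ)) N
  · rw [(ZMod.valMinAbs_spec _ b).2 ⟨rfl, hin⟩]
  · have hfar : 2 * m ≤ |(b : ZMod N).valMinAbs| := by
      rcases lt_or_ge (N : ℤ) (b * 2) with h | h
      · rw [(ZMod.valMinAbs_spec _ (b - N)).2 ⟨by simp, by constructor <;> omega⟩]
        exact le_abs.2 (by omega)
      · rw [Set.mem_Ioc] at hin
        rw [(ZMod.valMinAbs_spec _ (b + N)).2 ⟨by simp, by constructor <;> omega⟩]
        exact le_abs.2 (by omega)
    rw [Set.mem_Ioc] at hin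
    rw [cutSq_of_ge hm hfar, cutSq_of_ge hm (le_abs.2 (by omega))]

theorem cutSq_valMinAbs_add {N : ℕ} [NeZero N] {m : ℤ} (hm : 0 ≤ m) (hN : 4 * m + 2 ≤ N)
    (y : ZMod N) {e : ℤ} (he : |e| ≤ 1) :
    cutSq m (y + e).valMinAbs = cutSq m (y.valMinAbs + e) := by
  have h := two_mul_abs_valMinAbs_le y
  have h2 := abs_add_le y.valMinAbs e
  rw [← cutSq_valMinAbs_intCast hm hN (b := y.valMinAbs + e) (by omega), Int.cast_add,
    ZMod.coe_valMinAbs]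

/-! ### Barriers on the cylinder -/

/-- The exponent `α` for which `(‖u‖ ^ 2) ^ (-α)` has the decay `‖u‖ ^ (-(d - 1))` of the Green
function of `ℤ ^ (d + 1)`. -/
noncomputable def greenExponent (d : ℕ) : ℝ := ((d : ℝ) - 1) / 2

/-- A regularized squared distance to the origin of the cylinder, equal to `A + ‖u‖ ^ 2` at the
projection of a lattice point `u` with coordinates at most `m`. -/
noncomputable def cylQuad {d N : ℕ} (A : ℝ) (m : ℕ) (x : Cyl d N) : ℝ :=
  A + (∑ j, (cutSq m (x.1 j).valMinAbs : ℝ) + (x.2 : ℝ) ^ 2)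

/-- The directions in which a point of the torus lies at distance at least `m` from the origin. -/
def outerCoords {d N : ℕ} (m : ℕ) (y : Torus d N) : Finset (Fin d) :=
  {j | (m : ℤ) ≤ |(y j).valMinAbs|}

/-- A superharmonic function on the cylinder, of order one at the origin and nonnegative below
height `2 * η`. The power of `cylQuad` fails to be superharmonic where `cutSq` is not the square;
there the concave function of the height compensates. -/
noncomputable def barrier {d N : ℕ} (A : ℝ) (m η : ℕ) (x : Cyl d N) : ℝ :=
  cylQuad A m x ^ (-greenExponent d) - 16 * d * greenExponent d / (m : ℝ) ^ d *
    (√((m : ℝ) ^ 2 + (x.2 : ℝ) ^ 2) - √((m : ℝ) ^ 2 + (2 * (η : ℝ)) ^ 2))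

theorem greenExponent_ge {d : ℕ} (hd : 2 ≤ d) : 1 / 2 ≤ greenExponent d := by
  have : (2 : ℝ) ≤ d := by exact_mod_cast hd
  unfold greenExponent
  linarith

section Superharmonic

variable {d N m : ℕ}

theorem le_cylQuad (A : ℝ) (m : ℕ) (x : Cyl d N) : A ≤ cylQuad A m x := by
  have : 0 ≤ ∑ j, (cutSq m (x.1 j).valMinAbs : ℝ) :=
    Finset.sum_nonneg fun j _ => by exact_mod_cast cutSq_nonneg m _
  unfold cylQuad
  linarith [sq_nonneg (x.2 : ℝ)]

theorem cylQuad_horizontal [NeZero N] (hN : 4 * m + 2 ≤ N) (A : ℝ) (y : Torus d N) (z : ℤ)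
    (j : Fin d) {e : ℤ} (he : |e| ≤ 1) :
    cylQuad A m (y + Pi.single j (e : ZMod N), z) = cylQuad A m (y, z) +
      (cutSq m ((y j).valMinAbs + e) - cutSq m (y j).valMinAbs) := by
  have hsum : ∑ i, (cutSq m ((y + (Pi.single j (e : ZMod N) : Torus d N)) i).valMinAbs : ℝ) -
      ∑ i, (cutSq m (y i).valMinAbs : ℝ) =
      cutSq m ((y j).valMinAbs + e) - cutSq m (y j).valMinAbs := by
    rw [← Finset.sum_sub_distrib, Fintype.sum_eq_single j fun i hi => by
      rw [Pi.add_apply, Pi.single_eq_of_ne hi, add_zero, sub_self], Pi.add_apply,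
      Pi.single_eq_same, cutSq_valMinAbs_add (Int.natCast_nonneg m) (by exact_mod_cast hN) _ he]
  simp only [cylQuad]
  linarith

theorem cylQuad_vertical (A : ℝ) (m : ℕ) (y : Torus d N) (z e : ℤ) :
    cylQuad A m (y, z + e) = cylQuad A m (y, z) + (2 * e * z + e ^ 2 : ℝ) := by
  simp only [cylQuad]
  push_cast
  ring

theorem exists_stepAvg_cylQuad_rpow_le (hd : 2 ≤ d) : ∃ A : ℝ, 1 ≤ A ∧
    ∀ (N m : ℕ) [NeZero N], 1 ≤ m → 4 * m + 2 ≤ N → ∀ x : Cyl d N,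
      stepAvg (cylStep d N) (fun x => cylQuad A m x ^ (-greenExponent d)) x ≤
        cylQuad A m x ^ (-greenExponent d) + 2 * greenExponent d / (d + 1) *
          ((outerCoords m x.1).card * (cylQuad A m x ^ (-greenExponent d) / cylQuad A m x)) := by
  obtain ⟨A, hA, hkey⟩ := exists_rpow_neg_superharmonic (ι := Option (Fin d)) (greenExponent_ge hd)
    (by simp [greenExponent]; ring)
  refine ⟨A, hA, fun N m _ hm hN ⟨y, z⟩ => ?_⟩
  have hstep := hkey
    (fun o => o.elim ((z : ℝ) ^ 2) fun j => cutSq m (y j).valMinAbs)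
    (fun o => o.elim 0 fun j => if (m : ℤ) ≤ |(y j).valMinAbs| then 1 else 0)
    (fun o => o.elim (2 * z + 1) fun j => cutSq m ((y j).valMinAbs + 1) - cutSq m (y j).valMinAbs)
    (fun o => o.elim (-2 * z + 1) fun j => cutSq m ((y j).valMinAbs - 1) - cutSq m (y j).valMinAbs)
    (fun
      | none => sq_nonneg _
      | some j => Int.cast_nonneg (cutSq_nonneg m _))
    (fun
      | none => squareLikeIncrements_sq _
      | some j => squareLikeIncrements_cutSq (by exact_mod_cast hm) _)
  set Q := cylQuad A m (y, z) with hQdef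
  have hQ : A + ((z : ℝ) ^ 2 + ∑ j, (cutSq m (y j).valMinAbs : ℝ)) = Q := by
    rw [hQdef, cylQuad, add_comm ((z : ℝ) ^ 2)]
  have hQ0 : Q ≠ 0 := (lt_of_lt_of_le (by linarith) (le_cylQuad A m (y, z))).ne'
  have hplus : ∀ j, cylQuad A m (y + Pi.single j 1, z) =
      Q + (cutSq m ((y j).valMinAbs + 1) - cutSq m (y j).valMinAbs) := fun j => by
    simpa using cylQuad_horizontal hN A y z j (e := 1) (by simp)
  have hminus : ∀ j, cylQuad A m (y + Pi.single j (-1), z) =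
      Q + (cutSq m ((y j).valMinAbs - 1) - cutSq m (y j).valMinAbs) := fun j => by
    simpa [sub_eq_add_neg] using cylQuad_horizontal hN A y z j (e := -1) (by simp)
  have hup : cylQuad A m (y, z + 1) = Q + (2 * z + 1) := by
    simpa using cylQuad_vertical A m y z 1
  have hdown : cylQuad A m (y, z - 1) = Q + (-2 * z + 1) := by
    simpa [sub_eq_add_neg] using cylQuad_vertical A m y z (-1)
  simp only [Fintype.sum_option, Option.elim_none, Option.elim_some, hQ, zero_add,
    Finset.sum_boole, Fintype.card_option, Fintype.card_fin, Nat.cast_add, Nat.cast_one] at hstep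
  rw [stepAvg_eq_sum_div, sum_cylStep (fun x => cylQuad A m x ^ (-greenExponent d)),
    div_le_iff₀ (by positivity), add_comm]
  simp only [hplus, hminus, hup, hdown]
  refine hstep.trans (le_of_eq ?_)
  rw [← outerCoords]
  field_simp
  ring

theorem rpow_neg_greenExponent_div_le (hd : 2 ≤ d) {r s Q : ℝ} (hr : 0 < r) (hrs : r ≤ s)
    (hQ : s ^ 2 ≤ Q) : Q ^ (-greenExponent d) / Q ≤ r ^ 2 / (r ^ d * s ^ 3) := by
  have hs : 0 < s := hr.trans_le hrs
  have hQ0 : 0 < Q := lt_of_lt_of_le (by positivity) hQ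
  obtain ⟨k, rfl⟩ := Nat.exists_eq_add_of_le hd
  calc Q ^ (-greenExponent (2 + k)) / Q = Q ^ (-greenExponent (2 + k) - 1) :=
        (Real.rpow_sub_one hQ0.ne' _).symm
    _ ≤ (s ^ 2) ^ (-greenExponent (2 + k) - 1) :=
      Real.rpow_le_rpow_of_nonpos (by positivity) hQ (by linarith [greenExponent_ge hd])
    _ = (s ^ (k + 3))⁻¹ := by
      rw [← Real.rpow_natCast s 2, ← Real.rpow_mul hs.le, ← Real.rpow_natCast s (k + 3),
        ← Real.rpow_neg hs.le, greenExponent]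
      congr 1
      push_cast
      ring
    _ ≤ (r ^ k * s ^ 3)⁻¹ := by rw [pow_add]; gcongr
    _ = r ^ 2 / (r ^ (2 + k) * s ^ 3) := by rw [pow_add]; field_simp

theorem sq_add_sq_le_cylQuad {A : ℝ} (hA : 0 ≤ A) {x : Cyl d N}
    (hx : (outerCoords m x.1).Nonempty) :
    (m : ℝ) ^ 2 + (x.2 : ℝ) ^ 2 ≤ cylQuad A m x := by
  obtain ⟨j, hj⟩ := hx
  have hsingle := Finset.single_le_sum (f := fun i => (cutSq m (x.1 i).valMinAbs : ℝ))
    (fun i _ => Int.cast_nonneg (cutSq_nonneg m _)) (Finset.mem_univ j)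
  have hmj : (m : ℝ) ^ 2 ≤ cutSq m (x.1 j).valMinAbs := by
    exact_mod_cast sq_le_cutSq (Finset.mem_filter.1 hj).2
  unfold cylQuad
  linarith

theorem card_outerCoords_mul_rpow_le (hd : 2 ≤ d) {A : ℝ} (hA : 0 ≤ A) (hm : 1 ≤ m) (x : Cyl d N) :
    (outerCoords m x.1).card * (cylQuad A m x ^ (-greenExponent d) / cylQuad A m x) ≤
      d * ((m : ℝ) ^ 2 / ((m : ℝ) ^ d * √((m : ℝ) ^ 2 + (x.2 : ℝ) ^ 2) ^ 3)) := by
  rcases (outerCoords m x.1).eq_empty_or_nonempty with h | h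
  · rw [h, Finset.card_empty, Nat.cast_zero, zero_mul]
    positivity
  have hcard : ((outerCoords m x.1).card : ℝ) ≤ d := by
    exact_mod_cast (Finset.card_le_univ _).trans_eq (Fintype.card_fin d)
  refine mul_le_mul hcard ?_ ?_ (Nat.cast_nonneg d)
  · refine rpow_neg_greenExponent_div_le hd (by exact_mod_cast hm)
      (Real.le_sqrt_of_sq_le (le_add_of_nonneg_right (sq_nonneg _))) ?_
    rw [Real.sq_sqrt (by positivity)]
    exact sq_add_sq_le_cylQuad hA h
  · have hQ := hA.trans (le_cylQuad A m x)
    exact div_nonneg (Real.rpow_nonneg hQ _) hQ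

theorem add_le_stepAvg_sqrt (hm : 1 ≤ m) (x : Cyl d N) :
    √((m : ℝ) ^ 2 + (x.2 : ℝ) ^ 2) +
        (m : ℝ) ^ 2 / (8 * (d + 1) * √((m : ℝ) ^ 2 + (x.2 : ℝ) ^ 2) ^ 3) ≤
      stepAvg (cylStep d N) (fun x => √((m : ℝ) ^ 2 + (x.2 : ℝ) ^ 2)) x := by
  obtain ⟨y, z⟩ := x
  have hsecond := sqrt_second_difference (m := m) (z := z) (by exact_mod_cast hm)
  rw [stepAvg_eq_sum_div, sum_cylStep (fun x : Cyl d N => √((m : ℝ) ^ 2 + (x.2 : ℝ) ^ 2)),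
    le_div_iff₀ (by positivity)]
  simp only [Finset.sum_const, Finset.card_univ, Fintype.card_fin, nsmul_eq_mul]
  push_cast
  set s := √((m : ℝ) ^ 2 + (z : ℝ) ^ 2)
  have hs0 : 0 < s := Real.sqrt_pos.2 (by positivity)
  have hquot : (m : ℝ) ^ 2 / (8 * (d + 1) * s ^ 3) * (2 * (d + 1)) = m ^ 2 / (4 * s ^ 3) := by
    field_simp
    norm_num
  linarith

theorem exists_stepAvg_barrier_le (hd : 2 ≤ d) : ∃ A : ℝ, 1 ≤ A ∧
    ∀ (N m η : ℕ) [NeZero N], 1 ≤ m → 4 * m + 2 ≤ N → ∀ x : Cyl d N,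
      stepAvg (cylStep d N) (barrier A m η) x ≤ barrier A m η x := by
  obtain ⟨A, hA, hpower⟩ := exists_stepAvg_cylQuad_rpow_le hd
  refine ⟨A, hA, fun N m η _ hm hN x => ?_⟩
  have hα := greenExponent_ge hd
  set s := √((m : ℝ) ^ 2 + (x.2 : ℝ) ^ 2) with hs
  have hs0 : 0 < s := Real.sqrt_pos.2 (by positivity)
  set κ := 16 * d * greenExponent d / (m : ℝ) ^ d with hκ
  have hconcave := mul_le_mul_of_nonneg_left (add_le_stepAvg_sqrt hm x) (show 0 ≤ κ by positivity)
  have herror := mul_le_mul_of_nonneg_left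
    (card_outerCoords_mul_rpow_le hd (zero_le_one.trans hA) hm x)
    (show 0 ≤ 2 * greenExponent d / (d + 1) by positivity)
  have hcompensate : 2 * greenExponent d / (d + 1) * (d * ((m : ℝ) ^ 2 / ((m : ℝ) ^ d * s ^ 3))) =
      κ * ((m : ℝ) ^ 2 / (8 * (d + 1) * s ^ 3)) := by
    rw [hκ]
    field_simp
    norm_num
  have hbarrier : barrier A m η = fun x : Cyl d N => cylQuad A m x ^ (-greenExponent d) -
      κ * (√((m : ℝ) ^ 2 + (x.2 : ℝ) ^ 2) - √((m : ℝ) ^ 2 + (2 * (η : ℝ)) ^ 2)) := rfl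
  simp only [hbarrier]
  rw [stepAvg_sub, stepAvg_const_mul, stepAvg_sub, stepAvg_const]
  rw [← hs] at hconcave herror ⊢
  linarith [hpower N m hm hN x]

end Superharmonic

section BarrierBounds

variable {d N : ℕ}

theorem barrier_nonneg (hd : 2 ≤ d) {A : ℝ} (hA : 0 ≤ A) {m η : ℕ} {x : Cyl d N}
    (hx : |x.2| ≤ 2 * η) : 0 ≤ barrier A m η x := by
  have hα := greenExponent_ge hd
  have hsq : (x.2 : ℝ) ^ 2 ≤ (2 * (η : ℝ)) ^ 2 :=
    sq_le_sq.2 (by rw [abs_of_nonneg (a := 2 * (η : ℝ)) (by positivity)]; exact_mod_cast hx)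
  refine sub_nonneg.2 (le_trans ?_ (Real.rpow_nonneg (hA.trans (le_cylQuad A m x)) _))
  exact mul_nonpos_of_nonneg_of_nonpos (by positivity)
    (sub_nonpos.2 (Real.sqrt_le_sqrt (by linarith)))

theorem le_barrier_zero (hd : 2 ≤ d) (A : ℝ) (m η : ℕ) :
    A ^ (-greenExponent d) ≤ barrier A m η (0 : Cyl d N) := by
  have hα := greenExponent_ge hd
  have hzero : cylQuad A m (0 : Cyl d N) = A := by simp [cylQuad, cutSq]
  unfold barrier
  rw [hzero, le_sub_self_iff]
  refine mul_nonpos_of_nonneg_of_nonpos (by positivity)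
    (sub_nonpos.2 (Real.sqrt_le_sqrt ?_))
  simp only [Prod.snd_zero, Int.cast_zero]
  linarith [sq_nonneg (2 * (η : ℝ))]

theorem barrier_le (hd : 2 ≤ d) (A : ℝ) (m η : ℕ) (x : Cyl d N) :
    barrier A m η x ≤ cylQuad A m x ^ (-greenExponent d) +
      32 * d * greenExponent d * ((η : ℝ) / (m : ℝ) ^ d) := by
  have hα := greenExponent_ge hd
  have hupper : √((m : ℝ) ^ 2 + (2 * (η : ℝ)) ^ 2) ≤ m + 2 * η :=
    Real.sqrt_le_iff.2 ⟨by positivity, by nlinarith [show (0 : ℝ) ≤ m * η by positivity]⟩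
  have hlower : (m : ℝ) ≤ √((m : ℝ) ^ 2 + (x.2 : ℝ) ^ 2) :=
    Real.le_sqrt_of_sq_le (by linarith [sq_nonneg (x.2 : ℝ)])
  have hdiff : √((m : ℝ) ^ 2 + (2 * (η : ℝ)) ^ 2) - √((m : ℝ) ^ 2 + (x.2 : ℝ) ^ 2) ≤ 2 * η := by
    linarith
  calc barrier A m η x = cylQuad A m x ^ (-greenExponent d) +
        16 * d * greenExponent d / (m : ℝ) ^ d *
          (√((m : ℝ) ^ 2 + (2 * (η : ℝ)) ^ 2) - √((m : ℝ) ^ 2 + (x.2 : ℝ) ^ 2)) := by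
        unfold barrier; ring
    _ ≤ cylQuad A m x ^ (-greenExponent d) + 16 * d * greenExponent d / (m : ℝ) ^ d * (2 * η) := by
        gcongr
    _ = _ := by ring

theorem rpow_mul_reachProb_le_sum_barrier [NeZero N] (hd : 2 ≤ d) {A : ℝ} (hA : 0 ≤ A) {m η : ℕ}
    (hsuper : ∀ x : Cyl d N, stepAvg (cylStep d N) (barrier A m η) x ≤ barrier A m η x) {ζ : ℤ}
    {J : Finset (Cyl d N)} (hJ : (J : Set (Cyl d N)) ⊆ block d N (bigInterval η ζ)) {x : Cyl d N}
    (hx : x ∈ block d N (bigInterval η ζ)) :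
    A ^ (-greenExponent d) * reachProb (cylStep d N) (block d N (bigInterval η ζ)) J x ≤
      ∑ c ∈ J, barrier A m η (x - c) := by
  have hnonneg : ∀ y : Cyl d N, |y.2 - ζ| ≤ η → ∀ c ∈ J, 0 ≤ barrier A m η (y - c) :=
    fun y hy c hc => by
      obtain ⟨hc₁, hc₂⟩ : ζ - η < c.2 ∧ c.2 < ζ + η := hJ (Finset.mem_coe.2 hc)
      refine barrier_nonneg hd hA ?_
      rw [Prod.snd_sub]
      rw [abs_le] at hy ⊢
      omega
  refine mul_reachProb_le (u := fun y => ∑ c ∈ J, barrier A m η (y - c))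
    (exists_not_isOfFinAddOrder_cylStep d N) (finite_block η ζ) hJ (fun y hy p hp => ?_)
    (fun c hc => ?_) (fun y _ _ => ?_) hx
  · refine Finset.sum_nonneg (hnonneg _ ?_)
    rcases snd_add_cylStep_of_notMem hy hp with h | h <;> simp [h]
  · obtain ⟨hc₁, hc₂⟩ : ζ - η < c.2 ∧ c.2 < ζ + η := hJ hc
    calc A ^ (-greenExponent d) ≤ barrier A m η (c - c) := by
          rw [sub_self]; exact le_barrier_zero hd A m η
      _ ≤ _ := Finset.single_le_sum (f := fun c' => barrier A m η (c - c'))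
          (hnonneg c (abs_le.2 ⟨by omega, by omega⟩)) (Finset.mem_coe.1 hc)
  · rw [stepAvg_sum]
    refine Finset.sum_le_sum fun c _ => ?_
    rw [stepAvg_translate]
    exact hsuper _

end BarrierBounds

/-! ### Convergence of the capacities -/

section Projection

variable {d N : ℕ}

theorem exists_not_isOfFinAddOrder_unitStep (d : ℕ) : ∃ p, ¬ IsOfFinAddOrder (unitStep d p) := by
  refine ⟨(Fin.last d, true), fun h => ?_⟩
  obtain ⟨n, hn, hzero⟩ := isOfFinAddOrder_iff_nsmul_eq_zero.1 h
  simpa [unitStep, hn.ne'] using congrFun hzero (Fin.last d)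

theorem proj_add (u w : ZLat d) : proj d N (u + w) = proj d N u + proj d N w := by
  ext <;> simp [proj]

theorem proj_sub (u w : ZLat d) : proj d N (u - w) = proj d N u - proj d N w := by
  ext <;> simp [proj]

theorem stepAvg_cylStep_add_proj (f : Cyl d N → ℝ) (y : Cyl d N) (u : ZLat d) :
    stepAvg (cylStep d N) f (y + proj d N u) =
      stepAvg (unitStep d) (fun u => f (y + proj d N u)) u := by
  simp only [stepAvg, proj_add, add_assoc]

theorem cylDist_nonneg (x y : Cyl d N) : 0 ≤ cylDist x y :=
  Real.sInf_nonneg (by rintro r ⟨u, _, rfl⟩; exact Real.sqrt_nonneg _)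

theorem cylDist_le {x y : Cyl d N} {u : ZLat d} (h : proj d N u = x - y) :
    cylDist x y ≤ √(∑ j, (u j : ℝ) ^ 2) :=
  csInf_le ⟨0, by rintro r ⟨u, _, rfl⟩; exact Real.sqrt_nonneg _⟩ ⟨u, h, rfl⟩

theorem eq_of_proj_eq {u w : ZLat d} (h : proj d N u = proj d N w)
    (hlt : ∀ j, |u j - w j| < N) : u = w := by
  funext j
  induction j using Fin.lastCases with
  | last => exact congrArg Prod.snd h
  | cast j =>
    have hmod : ((w j.castSucc : ℤ) : ZMod N) = (u j.castSucc : ℤ) :=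
      (congrFun (congrArg Prod.fst h) j).symm
    exact sub_eq_zero.1 (Int.eq_zero_of_abs_lt_dvd
      ((ZMod.intCast_eq_intCast_iff_dvd_sub _ _ _).1 hmod) (hlt _))

theorem cylQuad_proj [NeZero N] {m : ℕ} (hN : 4 * m + 2 ≤ N) (A : ℝ) {u : ZLat d}
    (hu : ∀ j, |u j| ≤ m) : cylQuad A m (proj d N u) = A + ∑ j, (u j : ℝ) ^ 2 := by
  rw [Fin.sum_univ_castSucc]
  unfold cylQuad proj
  congr 2
  refine Finset.sum_congr rfl fun j _ => ?_
  have := hu j.castSucc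
  rw [cutSq_valMinAbs_intCast (Int.natCast_nonneg m) (by omega) (by omega), cutSq_of_le this,
    Int.cast_pow]

theorem cylDist_sq_le [NeZero N] {m : ℕ} (hN : N ≤ 8 * m) {A : ℝ} (hA : 0 ≤ A)
    (x y : Cyl d N) (w : ZLat d) :
    cylDist x y ^ 2 ≤ 32 * cylQuad A m (x - y + proj d N w) + 2 * ∑ j, (w j : ℝ) ^ 2 := by
  set r := x - y + proj d N w with hr
  set u : ZLat d := Fin.snoc (α := fun _ => ℤ) (fun j => (r.1 j).valMinAbs) r.2 with hu
  have hproj : proj d N (u - w) = x - y := by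
    rw [proj_sub, show proj d N u = r by ext <;> simp [proj, hu], hr, add_sub_cancel_right]
  have hquad : ∑ j, (u j : ℝ) ^ 2 ≤ 16 * cylQuad A m r := by
    have hcut : ∑ j, ((r.1 j).valMinAbs : ℝ) ^ 2 ≤ 16 * ∑ j, (cutSq m (r.1 j).valMinAbs : ℝ) := by
      rw [Finset.mul_sum]
      refine Finset.sum_le_sum fun j _ => ?_
      have := two_mul_abs_valMinAbs_le (r.1 j)
      exact_mod_cast sq_le_sixteen_mul_cutSq (m := m) (a := (r.1 j).valMinAbs) (by omega)
    rw [Fin.sum_univ_castSucc]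
    simp only [hu, Fin.snoc_castSucc, Fin.snoc_last, cylQuad]
    linarith [sq_nonneg (r.2 : ℝ)]
  calc cylDist x y ^ 2 ≤ √(∑ j, ((u - w) j : ℝ) ^ 2) ^ 2 :=
        pow_le_pow_left₀ (cylDist_nonneg x y) (cylDist_le hproj) 2
    _ = ∑ j, ((u - w) j : ℝ) ^ 2 := Real.sq_sqrt (Finset.sum_nonneg fun j _ => sq_nonneg _)
    _ ≤ ∑ j, (2 * (u j : ℝ) ^ 2 + 2 * (w j : ℝ) ^ 2) := Finset.sum_le_sum fun j _ => by
      rw [Pi.sub_apply, Int.cast_sub]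
      linarith [sq_nonneg ((u j : ℝ) + w j)]
    _ = 2 * ∑ j, (u j : ℝ) ^ 2 + 2 * ∑ j, (w j : ℝ) ^ 2 := by
      rw [Finset.mul_sum, Finset.mul_sum, Finset.sum_add_distrib]
    _ ≤ _ := by linarith

theorem exists_forall_abs_apply_le (u : ZLat d) : ∃ n : ℕ, ∀ j, |u j| ≤ n :=
  ⟨∑ j, (u j).natAbs, fun j => by
    rw [Int.abs_eq_natAbs]
    exact_mod_cast Finset.single_le_sum (f := fun j => (u j).natAbs) (fun _ _ => Nat.zero_le _)
      (Finset.mem_univ j)⟩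

theorem tendsto_sum_sq_cofinite (d : ℕ) (A : ℝ) :
    Tendsto (fun u : ZLat d => A + ∑ j, (u j : ℝ) ^ 2) cofinite atTop := by
  refine tendsto_atTop_add_const_left _ A (tendsto_atTop_mono (fun u => ?_)
    (Filter.cocompact_eq_cofinite (ZLat d) ▸ tendsto_norm_cocompact_atTop (E := ZLat d)))
  refine (pi_norm_le_iff_of_nonneg (Finset.sum_nonneg fun j _ => sq_nonneg _)).2 fun j => ?_
  calc ‖u j‖ ≤ (u j : ℝ) ^ 2 := by
        rw [Int.norm_eq_abs, ← sq_abs]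
        exact_mod_cast Int.le_self_sq |u j|
    _ ≤ _ := Finset.single_le_sum (f := fun j => (u j : ℝ) ^ 2) (fun _ _ => sq_nonneg _)
      (Finset.mem_univ j)

end Projection

/-- The union over `i ∈ I` of the sets `y i + π_E(K i)`, encoded as the image of a disjoint union so
that, when the sets are disjoint, sums over it split. -/
def translates {ι : Type*} {d N : ℕ} (I : Finset ι) (K : ι → Finset (ZLat d)) (y : ι → Cyl d N) :
    Finset (Cyl d N) :=
  (I.sigma K).image fun p => y p.1 + proj d N p.2

section Translates

variable {ι : Type*} {d : ℕ} {I : Finset ι} {K : ι → Finset (ZLat d)}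

theorem mem_translates {N : ℕ} {y : ι → Cyl d N} {c : Cyl d N} :
    c ∈ translates I K y ↔ ∃ i ∈ I, ∃ u ∈ K i, y i + proj d N u = c := by
  simp [translates, and_assoc]

variable {x : (N : ℕ) → ι → Cyl d N}

theorem eventually_translates_subset {W : (N : ℕ) → Set (Cyl d N)}
    (hW : ∀ i ∈ I, ∀ u, ∀ᶠ N in atTop, x N i + proj d N u ∈ W N) :
    ∀ᶠ N in atTop, (translates I K (x N) : Set (Cyl d N)) ⊆ W N := by
  have hall : ∀ᶠ N in atTop, ∀ i ∈ I, ∀ u ∈ K i, x N i + proj d N u ∈ W N :=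
    (Finset.eventually_all I).2 fun i hi => (Finset.eventually_all (K i)).2 fun u _ => hW i hi u
  filter_upwards [hall] with N hN c hc
  obtain ⟨i, hi, u, hu, rfl⟩ := mem_translates.1 (Finset.mem_coe.1 hc)
  exact hN i hi u hu

theorem eventually_add_proj_ne {i j : ι}
    (hx : i ≠ j → Tendsto (fun N => cylDist (x N i) (x N j)) atTop atTop)
    {u k : ZLat d} (hne : i = j → u ≠ k) :
    ∀ᶠ N in atTop, x N i + proj d N u ≠ x N j + proj d N k := by
  by_cases hij : i = j
  · subst hij
    obtain ⟨n, hn⟩ := exists_forall_abs_apply_le (u - k)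
    filter_upwards [eventually_gt_atTop n] with N hN heq
    exact hne rfl (eq_of_proj_eq (add_left_cancel heq) fun l =>
      (hn l).trans_lt (by exact_mod_cast hN))
  · filter_upwards [(hx hij).eventually_gt_atTop (√(∑ l, ((k - u) l : ℝ) ^ 2))] with N hN heq
    refine (cylDist_le ?_).not_gt hN
    rw [proj_sub, sub_eq_sub_iff_add_eq_add, add_comm, ← heq, add_comm]

theorem eventually_injOn_add_proj
    (hx : (I : Set ι).Pairwise fun i j => Tendsto (fun N => cylDist (x N i) (x N j)) atTop atTop) :
    ∀ᶠ N in atTop, Set.InjOn (fun p : Σ _ : ι, ZLat d => x N p.1 + proj d N p.2) (I.sigma K) := by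
  have hall : ∀ᶠ N in atTop, ∀ p ∈ I.sigma K, ∀ q ∈ I.sigma K, p ≠ q →
      x N p.1 + proj d N p.2 ≠ x N q.1 + proj d N q.2 := by
    refine (Finset.eventually_all _).2 fun ⟨i, u⟩ hp => (Finset.eventually_all _).2
      fun ⟨j, k⟩ hq => ?_
    by_cases hne : (⟨i, u⟩ : Σ _ : ι, ZLat d) = ⟨j, k⟩
    · exact .of_forall fun N h => absurd hne h
    · refine (eventually_add_proj_ne (fun hij => hx (Finset.mem_sigma.1 hp).1
        (Finset.mem_sigma.1 hq).1 hij) ?_).mono fun N h _ => h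
      rintro rfl rfl
      exact hne rfl
  filter_upwards [hall] with N hN p hp q hq heq
  by_contra hne
  exact hN p hp q hq hne heq

theorem eventually_add_proj_notMem_translates
    (hx : (I : Set ι).Pairwise fun i j => Tendsto (fun N => cylDist (x N i) (x N j)) atTop atTop)
    {i : ι} (hi : i ∈ I) {u : ZLat d} (hu : u ∉ K i) :
    ∀ᶠ N in atTop, x N i + proj d N u ∉ translates I K (x N) := by
  have hall : ∀ᶠ N in atTop, ∀ j ∈ I, ∀ k ∈ K j, x N i + proj d N u ≠ x N j + proj d N k :=
    (Finset.eventually_all _).2 fun j hj => (Finset.eventually_all _).2 fun k hk =>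
      eventually_add_proj_ne (hx hi hj) (by rintro rfl rfl; exact hu hk)
  filter_upwards [hall] with N hN hmem
  obtain ⟨j, hj, k, hk, heq⟩ := mem_translates.1 hmem
  exact hN j hj k hk heq.symm

end Translates

section Limits

variable {d : ℕ} {h : ℕ → ℕ}

theorem tendsto_height_div_scale_pow
    (hh : Tendsto (fun N => (h N : ℝ) / (N : ℝ) ^ d) atTop (𝓝 0)) :
    Tendsto (fun N => (h N : ℝ) / (((N - 2) / 4 : ℕ) : ℝ) ^ d) atTop (𝓝 0) := by
  have hlim := hh.const_mul ((8 : ℝ) ^ d)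
  rw [mul_zero] at hlim
  refine squeeze_zero' (.of_forall fun N => by positivity) ?_ hlim
  filter_upwards [eventually_ge_atTop 10] with N hN
  have hscale : (N : ℝ) ≤ 8 * (((N - 2) / 4 : ℕ) : ℝ) := by
    exact_mod_cast (by omega : N ≤ 8 * ((N - 2) / 4))
  have hN0 : (0 : ℝ) < N := by exact_mod_cast (by omega : 0 < N)
  have hm0 : (0 : ℝ) < (((N - 2) / 4 : ℕ) : ℝ) := by linarith
  rw [← mul_div_assoc, div_le_div_iff₀ (by positivity) (by positivity)]
  calc (h N : ℝ) * (N : ℝ) ^ d ≤ h N * (8 * (((N - 2) / 4 : ℕ) : ℝ)) ^ d := by gcongr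
    _ = _ := by rw [mul_pow]; ring

theorem tendsto_cylQuad_proj_rpow (A : ℝ) (w : ZLat d) :
    Tendsto (fun N => cylQuad A ((N - 2) / 4) (proj d N w) ^ (-greenExponent d)) atTop
      (𝓝 ((A + ∑ l, (w l : ℝ) ^ 2) ^ (-greenExponent d))) := by
  obtain ⟨n, hn⟩ := exists_forall_abs_apply_le w
  refine tendsto_const_nhds.congr' ?_
  filter_upwards [eventually_ge_atTop (4 * n + 10)] with N hN
  have : NeZero N := ⟨by omega⟩
  rw [cylQuad_proj (by omega) A fun l => (hn l).trans (by omega)]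

theorem tendsto_cylQuad_rpow_zero (hd : 2 ≤ d) {A : ℝ} (hA : 0 ≤ A) {y y' : (N : ℕ) → Cyl d N}
    (hy : Tendsto (fun N => cylDist (y N) (y' N)) atTop atTop) (w : ZLat d) :
    Tendsto (fun N => cylQuad A ((N - 2) / 4) (y N - y' N + proj d N w) ^ (-greenExponent d)) atTop
      (𝓝 0) := by
  have hα := greenExponent_ge hd
  refine (tendsto_rpow_neg_atTop (by linarith : 0 < greenExponent d)).comp ?_
  have hdist : Tendsto (fun N => (cylDist (y N) (y' N) ^ 2 - 2 * ∑ l, (w l : ℝ) ^ 2) / 32)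
      atTop atTop :=
    (tendsto_atTop_add_const_right _ _ ((tendsto_pow_atTop two_ne_zero).comp hy)).atTop_div_const
      (by norm_num)
  refine tendsto_atTop_mono' _ ?_ hdist
  filter_upwards [eventually_ge_atTop 10] with N hN
  have : NeZero N := ⟨by omega⟩
  rw [div_le_iff₀ (by norm_num)]
  linarith [cylDist_sq_le (m := (N - 2) / 4) (by omega) hA (y N) (y' N) w]

theorem tendsto_sum_rpow_cofinite_zero (hd : 2 ≤ d) (A : ℝ) (K : Finset (ZLat d)) :
    Tendsto (fun u => ∑ k ∈ K, (A + ∑ l, ((u - k) l : ℝ) ^ 2) ^ (-greenExponent d)) cofinite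
      (𝓝 0) := by
  have hα := greenExponent_ge hd
  rw [← Finset.sum_const_zero (s := K)]
  exact tendsto_finsetSum _ fun k _ =>
    (tendsto_rpow_neg_atTop (by linarith)).comp
      ((tendsto_sum_sq_cofinite d A).comp (sub_left_injective (b := k)).tendsto_cofinite)

variable {ι : Type*} {I : Finset ι} {K : ι → Finset (ZLat d)} {x : (N : ℕ) → ι → Cyl d N}
  {ζ : ℕ → ℤ}
  (hx : (I : Set ι).Pairwise fun i j => Tendsto (fun N => cylDist (x N i) (x N j)) atTop atTop)

include hx

theorem tendsto_sum_cylQuad_rpow (hd : 2 ≤ d) {A : ℝ} (hA : 0 ≤ A) {i : ι} (hi : i ∈ I)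
    (w : ZLat d) :
    Tendsto (fun N => ∑ p ∈ I.sigma K,
        cylQuad A ((N - 2) / 4) (x N i - x N p.1 + proj d N (w - p.2)) ^ (-greenExponent d)) atTop
      (𝓝 (∑ k ∈ K i, (A + ∑ l, ((w - k) l : ℝ) ^ 2) ^ (-greenExponent d))) := by
  classical
  have hlimit : ∑ k ∈ K i, (A + ∑ l, ((w - k) l : ℝ) ^ 2) ^ (-greenExponent d) =
      ∑ p ∈ I.sigma K, if p.1 = i then
        (A + ∑ l, ((w - p.2) l : ℝ) ^ 2) ^ (-greenExponent d) else 0 := by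
    rw [Finset.sum_sigma, Finset.sum_eq_single_of_mem i hi fun j _ hj => by simp [hj]]
    simp
  rw [hlimit]
  refine tendsto_finsetSum _ fun ⟨j, k⟩ hp => ?_
  by_cases hj : j = i
  · subst hj
    simpa using tendsto_cylQuad_proj_rpow A (w - k)
  · simpa [hj] using tendsto_cylQuad_rpow_zero hd hA
      (hx hi (Finset.mem_sigma.1 hp).1 (Ne.symm hj)) (w - k)

variable (hblock : ∀ i ∈ I, ∀ u, ∀ᶠ N in atTop,
  x N i + proj d N u ∈ block d N (bigInterval (h N) (ζ N)))

include hblock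

theorem eventually_rpow_mul_reachProb_le (hd : 2 ≤ d) {A : ℝ} (hA : 0 ≤ A)
    (hsuper : ∀ (N m η : ℕ) [NeZero N], 1 ≤ m → 4 * m + 2 ≤ N → ∀ y : Cyl d N,
      stepAvg (cylStep d N) (barrier A m η) y ≤ barrier A m η y)
    {i : ι} (hi : i ∈ I) (w : ZLat d) :
    ∀ᶠ N in atTop, A ^ (-greenExponent d) *
        reachProb (cylStep d N) (block d N (bigInterval (h N) (ζ N))) (translates I K (x N))
          (x N i + proj d N w) ≤
      ∑ p ∈ I.sigma K, (cylQuad A ((N - 2) / 4) (x N i - x N p.1 + proj d N (w - p.2)) ^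
          (-greenExponent d) +
        32 * d * greenExponent d * ((h N : ℝ) / (((N - 2) / 4 : ℕ) : ℝ) ^ d)) := by
  filter_upwards [eventually_translates_subset (K := K) hblock,
    eventually_injOn_add_proj (K := K) hx,
    hblock i hi w, eventually_ge_atTop 10] with N hsub hinj hw hN
  have : NeZero N := ⟨by omega⟩
  refine (rpow_mul_reachProb_le_sum_barrier hd hA
    (hsuper N ((N - 2) / 4) (h N) (by omega) (by omega)) hsub hw).trans ?_
  rw [translates, Finset.sum_image hinj]
  refine Finset.sum_le_sum fun p _ => (barrier_le hd A _ _ _).trans_eq ?_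
  rw [proj_sub, add_sub_add_comm]

theorem rpow_mul_limit_reachProb_le (hd : 2 ≤ d)
    (hh : Tendsto (fun N => (h N : ℝ) / (N : ℝ) ^ d) atTop (𝓝 0)) {A : ℝ} (hA : 0 ≤ A)
    (hsuper : ∀ (N m η : ℕ) [NeZero N], 1 ≤ m → 4 * m + 2 ≤ N → ∀ y : Cyl d N,
      stepAvg (cylStep d N) (barrier A m η) y ≤ barrier A m η y)
    {i : ι} (hi : i ∈ I) {w : ZLat d} {g : Filter ℕ} [g.NeBot] (hg : g ≤ atTop) {a : ℝ}
    (ha : Tendsto (fun N => reachProb (cylStep d N) (block d N (bigInterval (h N) (ζ N)))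
      (translates I K (x N)) (x N i + proj d N w)) g (𝓝 a)) :
    A ^ (-greenExponent d) * a ≤
      ∑ k ∈ K i, (A + ∑ l, ((w - k) l : ℝ) ^ 2) ^ (-greenExponent d) := by
  have hbound := (tendsto_sum_cylQuad_rpow (K := K) hx hd hA hi w).add
    (((tendsto_height_div_scale_pow hh).const_mul (32 * d * greenExponent d)).const_mul
      ((I.sigma K).card : ℝ))
  rw [mul_zero, mul_zero, add_zero] at hbound
  refine le_of_tendsto_of_tendsto (ha.const_mul _) (hbound.mono_left hg) (hg ?_)
  filter_upwards [eventually_rpow_mul_reachProb_le (K := K) hx hblock hd hA hsuper hi w] with N hN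
  rwa [Finset.sum_add_distrib, Finset.sum_const, nsmul_eq_mul] at hN

/-- A subsequential limit inherits the boundary values and the harmonicity, and the barriers
force it to vanish at infinity. -/
theorem limit_reachProb_eq (hd : 2 ≤ d)
    (hh : Tendsto (fun N => (h N : ℝ) / (N : ℝ) ^ d) atTop (𝓝 0)) {i : ι} (hi : i ∈ I)
    {g : Filter ℕ} [g.NeBot] (hg : g ≤ atTop) {V : ZLat d → ℝ}
    (hV : ∀ u, Tendsto (fun N => reachProb (cylStep d N) (block d N (bigInterval (h N) (ζ N)))
      (translates I K (x N)) (x N i + proj d N u)) g (𝓝 (V u))) (u : ZLat d) :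
    V u = reachProb (unitStep d) Set.univ (K i) u := by
  have hV₀ : ∀ u, 0 ≤ V u := fun u => ge_of_tendsto' (hV u) fun N => reachProb_nonneg
  refine eq_reachProb_univ (exists_not_isOfFinAddOrder_unitStep d) (K i).finite_toSet hV₀
    (fun k hk => ?_) (fun w hw => ?_) ?_ u
  · refine tendsto_nhds_unique (hV k) (tendsto_const_nhds.congr fun N => ?_)
    exact (reachProb_of_mem (Finset.mem_coe.2 (mem_translates.2 ⟨i, hi, k, hk, rfl⟩))).symm
  · refine tendsto_nhds_unique ((hV w).congr' (hg ?_))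
      (tendsto_stepAvg (unitStep d) hV w)
    filter_upwards [eventually_add_proj_notMem_translates hx hi hw, hblock i hi w] with N hC hB
    rw [reachProb_eq_stepAvg hB hC, stepAvg_cylStep_add_proj]
  · obtain ⟨A, hA, hsuper⟩ := exists_stepAvg_barrier_le hd
    have hlim := (tendsto_sum_rpow_cofinite_zero hd A (K i)).const_mul (A ^ greenExponent d)
    rw [mul_zero] at hlim
    refine squeeze_zero hV₀ (fun w => ?_) hlim
    have hw := rpow_mul_limit_reachProb_le hx hblock hd hh (by linarith) hsuper hi hg (hV w)
    rwa [Real.rpow_neg (by linarith), inv_mul_le_iff₀ (by positivity)] at hw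

theorem tendsto_reachProb (hd : 2 ≤ d)
    (hh : Tendsto (fun N => (h N : ℝ) / (N : ℝ) ^ d) atTop (𝓝 0)) {i : ι} (hi : i ∈ I)
    (u : ZLat d) :
    Tendsto (fun N => reachProb (cylStep d N) (block d N (bigInterval (h N) (ζ N)))
        (translates I K (x N)) (x N i + proj d N u)) atTop
      (𝓝 (reachProb (unitStep d) Set.univ (K i) u)) := by
  rw [tendsto_iff_ultrafilter]
  intro g hg
  have hcompact : ∀ u, ∃ a, Tendsto (fun N => reachProb (cylStep d N)
      (block d N (bigInterval (h N) (ζ N))) (translates I K (x N)) (x N i + proj d N u)) g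
        (𝓝 a) := fun u => by
    obtain ⟨a, -, ha⟩ := (isCompact_Icc (a := (0 : ℝ)) (b := 1)).ultrafilter_le_nhds
      (g.map fun N => reachProb (cylStep d N) (block d N (bigInterval (h N) (ζ N)))
        (translates I K (x N)) (x N i + proj d N u))
      (le_principal_iff.2 (Filter.mem_map.2
        (Filter.univ_mem' fun N => ⟨reachProb_nonneg, reachProb_le_one⟩)))
    exact ⟨a, ha⟩
  choose V hV using hcompact
  exact limit_reachProb_eq hx hblock hd hh hi hg hV u ▸ hV u

theorem tendsto_cylCap (hd : 2 ≤ d)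
    (hh : Tendsto (fun N => (h N : ℝ) / (N : ℝ) ^ d) atTop (𝓝 0)) :
    Tendsto (fun N => cylCap (block d N (bigInterval (h N) (ζ N))) (translates I K (x N))) atTop
      (𝓝 (∑ i ∈ I, latticeCap (K i))) := by
  have hlim : Tendsto (fun N => ∑ i ∈ I, ∑ k ∈ K i, (1 - stepAvg (unitStep d)
      (fun u => reachProb (cylStep d N) (block d N (bigInterval (h N) (ζ N)))
        (translates I K (x N)) (x N i + proj d N u)) k)) atTop
      (𝓝 (∑ i ∈ I, latticeCap (K i))) := by
    refine tendsto_finsetSum _ fun i hi => tendsto_finsetSum _ fun k _ => ?_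
    rw [latticeLaw, walkLaw_real_hitTime_eq_top]
    exact (tendsto_stepAvg _ (tendsto_reachProb hx hblock hd hh hi) k).const_sub 1
  refine hlim.congr' ?_
  filter_upwards [eventually_translates_subset (K := K) hblock,
    eventually_injOn_add_proj (K := K) hx,
    eventually_ge_atTop 1] with N hsub hinj hN
  have : NeZero N := ⟨by omega⟩
  rw [cylCap_eq_sum (finite_block (h N) (ζ N)) hsub, Finset.sum_sigma']
  conv_rhs => rw [translates, Finset.sum_image hinj]
  exact Finset.sum_congr rfl fun p _ => by rw [stepAvg_cylStep_add_proj, translates]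

end Limits

/-! ### Clusters -/

section Clusters

variable {d M : ℕ} {x : (N : ℕ) → Fin M → Cyl d N} {v : Fin M → ℝ}

theorem mem_cluster {a : ℝ} {i : Fin M} : i ∈ cluster v a ↔ v i = a := by
  simp [cluster]

theorem cluster_nonempty {a : ℝ} (ha : a ∈ Set.range v) : (cluster v a).Nonempty :=
  let ⟨i, hi⟩ := ha
  ⟨i, mem_cluster.2 hi⟩

theorem clusterSet_eq_translates {N : ℕ} (y : Fin M → Cyl d N) (K : Fin M → Finset (ZLat d))
    (v : Fin M → ℝ) (a : ℝ) : clusterSet y K v a = translates (cluster v a) K y := by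
  ext c
  simp [clusterSet, mem_translates]

theorem exists_topHeight_eq {N : ℕ} (y : Fin M → Cyl d N) {a : ℝ} (ha : a ∈ Set.range v) :
    ∃ i ∈ cluster v a, topHeight y v a = (y i).2 := by
  obtain ⟨i, hi, h⟩ : topHeight y v a ∈ (fun i => (y i).2) '' (cluster v a : Set (Fin M)) :=
    Int.csSup_mem (Set.Nonempty.image _ (cluster_nonempty ha))
      ((Finset.finite_toSet _).image _).bddAbove
  exact ⟨i, hi, h.symm⟩

theorem eventually_topHeight_separated
    (hv : ∀ i, Tendsto (fun N => ((x N i).2 : ℝ) / (N : ℝ) ^ d) atTop (𝓝 (v i))) {h : ℕ → ℕ}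
    (hh : Tendsto (fun N => (h N : ℝ) / (N : ℝ) ^ d) atTop (𝓝 0)) {a b : ℝ} (hab : a ≠ b)
    (ha : a ∈ Set.range v) (hb : b ∈ Set.range v) :
    ∀ᶠ N in atTop, 2 * (h N : ℤ) ≤ |topHeight (x N) v a - topHeight (x N) v b| := by
  have hall : ∀ᶠ N in atTop, ∀ i ∈ cluster v a, ∀ j ∈ cluster v b,
      2 * (h N : ℤ) ≤ |(x N i).2 - (x N j).2| := by
    refine (Finset.eventually_all _).2 fun i hi => (Finset.eventually_all _).2 fun j hj => ?_
    have hpos : (2 : ℝ) * 0 < |v i - v j| := by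
      rw [mem_cluster.1 hi, mem_cluster.1 hj, mul_zero]
      exact abs_pos.2 (sub_ne_zero.2 hab)
    filter_upwards [(hh.const_mul 2).eventually_lt ((hv i).sub (hv j)).abs hpos,
      eventually_gt_atTop 0] with N hlt hN
    have hN' : (0 : ℝ) < (N : ℝ) ^ d := pow_pos (by exact_mod_cast hN) _
    rw [← sub_div, abs_div, abs_of_pos hN', ← mul_div_assoc, div_lt_div_iff_of_pos_right hN']
      at hlt
    exact_mod_cast hlt.le
  filter_upwards [hall] with N hN
  obtain ⟨i, hi, htop_a⟩ := exists_topHeight_eq (x N) ha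
  obtain ⟨j, hj, htop_b⟩ := exists_topHeight_eq (x N) hb
  rw [htop_a, htop_b]
  exact hN i hi j hj

variable {δ : ℕ → ℕ} (hδ : ∀ i j, v i = v j →
  (fun N => 1 + |((x N i).2 : ℝ) - ((x N j).2 : ℝ)|) =o[atTop] (fun N => (δ N : ℝ)))
include hδ

theorem eventually_abs_sub_topHeight_add_le {a : ℝ} {i : Fin M} (hi : i ∈ cluster v a) (c : ℕ) :
    ∀ᶠ N in atTop, |(x N i).2 - topHeight (x N) v a| + c ≤ δ N := by
  have hall : ∀ᶠ N in atTop, ∀ j ∈ cluster v a, |(x N i).2 - (x N j).2| + c ≤ δ N := by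
    refine (Finset.eventually_all _).2 fun j hj => ?_
    have hsmall := isLittleO_iff_nat_mul_le.1
      (hδ i j ((mem_cluster.1 hi).trans (mem_cluster.1 hj).symm)) (c + 1)
    filter_upwards [hsmall] with N hN
    rw [Real.norm_of_nonneg (by positivity), Real.norm_natCast] at hN
    have hZ : ((c : ℤ) + 1) * (1 + |(x N i).2 - (x N j).2|) ≤ δ N := by exact_mod_cast hN
    nlinarith [abs_nonneg ((x N i).2 - (x N j).2)]
  filter_upwards [hall] with N hN
  obtain ⟨j, hj, htop⟩ := exists_topHeight_eq (x N) ⟨i, mem_cluster.1 hi⟩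
  exact htop ▸ hN j hj

theorem eventually_add_proj_mem_block_smallInterval {a : ℝ} {i : Fin M} (hi : i ∈ cluster v a)
    (u : ZLat d) : ∀ᶠ N in atTop,
      x N i + proj d N u ∈ block d N (smallInterval (δ N) (topHeight (x N) v a)) := by
  filter_upwards [eventually_abs_sub_topHeight_add_le hδ hi (u (Fin.last d)).natAbs] with N hN
  have habs := abs_le.1 (le_refl |(x N i).2 - topHeight (x N) v a|)
  change _ ≤ (x N i).2 + u (Fin.last d) ∧ (x N i).2 + u (Fin.last d) ≤ _
  omega

variable {h : ℕ → ℕ} (hδh : (fun N => (δ N : ℝ)) =o[atTop] (fun N => (h N : ℝ)))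
include hδh

theorem eventually_pos_and_two_mul_le {a : ℝ} (ha : a ∈ Set.range v) :
    ∀ᶠ N in atTop, 0 < h N ∧ 2 * δ N ≤ h N := by
  obtain ⟨i, hi⟩ := cluster_nonempty ha
  filter_upwards [isLittleO_iff_nat_mul_le.1 hδh 2,
    eventually_abs_sub_topHeight_add_le hδ hi 1] with N hN hpos
  have hle : 2 * δ N ≤ h N := by
    rw [Real.norm_natCast, Real.norm_natCast] at hN
    exact_mod_cast hN
  have := abs_nonneg ((x N i).2 - topHeight (x N) v a)
  omega

theorem eventually_add_proj_mem_block_bigInterval {a : ℝ} {i : Fin M} (hi : i ∈ cluster v a)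
    (u : ZLat d) : ∀ᶠ N in atTop,
      x N i + proj d N u ∈ block d N (bigInterval (h N) (topHeight (x N) v a)) := by
  filter_upwards [eventually_add_proj_mem_block_smallInterval hδ hi u,
    eventually_pos_and_two_mul_le hδ hδh ⟨i, mem_cluster.1 hi⟩] with N hmem hle
  exact smallInterval_subset_bigInterval (by omega) _ hmem

end Clusters

end CylinderWalk

theorem lemma4p2_general {d : ℕ} (hd : 2 ≤ d) {M L : ℕ} (K : Fin M → Finset (ZLat d))
    {x : (N : ℕ) → Fin M → Cyl d N} {v : Fin M → ℝ}
    (hx : Pairwise fun i j => Tendsto (fun N => cylDist (x N i) (x N j)) atTop atTop)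
    (hv : ∀ i, Tendsto (fun N => ((x N i).2 : ℝ) / (N : ℝ) ^ d) atTop (𝓝 (v i)))
    {w : Fin L → ℝ} (hw : Function.Injective w) (hwv : Set.range w ⊆ Set.range v) {h δ : ℕ → ℕ}
    (hh : (fun N => (h N : ℝ)) =o[atTop] (fun N => (N : ℝ) ^ d))
    (hδh : (fun N => (δ N : ℝ)) =o[atTop] (fun N => (h N : ℝ)))
    (hδ : ∀ i j, v i = v j →
      (fun N => 1 + |((x N i).2 : ℝ) - ((x N j).2 : ℝ)|) =o[atTop] (fun N => (δ N : ℝ))) :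
    (∀ᶠ N : ℕ in atTop, ∀ l : Fin L,
      ∀ z₁ ∈ smallInterval (δ N) (topHeight (x N) v (w l)),
      ∀ z₂ ∈ bdry (bigInterval (h N) (topHeight (x N) v (w l))),
        ∃ Ψ : ℝ, |Ψ| ≤ 20 * ((δ N : ℝ) / (h N : ℝ)) ∧
          (excursionLaw d N (δ N) (h N) (fun m => topHeight (x N) v (w m)) z₁ z₂).real
              {X | entranceTime (clusterSet (x N) K v (w l) : Set (Cyl d N)) X <
                exitTime (block d N (bigInterval (h N) (topHeight (x N) v (w l)))) X} =
            ((d : ℝ) + 1) * ((h N : ℝ) / (N : ℝ) ^ d) *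
              cylCap (block d N (bigInterval (h N) (topHeight (x N) v (w l))))
                (clusterSet (x N) K v (w l)) * (1 + Ψ)) ∧
    (∀ l : Fin L,
      Tendsto
        (fun N => cylCap (block d N (bigInterval (h N) (topHeight (x N) v (w l))))
          (clusterSet (x N) K v (w l)))
        atTop (𝓝 (∑ i ∈ cluster v (w l), latticeCap (K i)))) := by
  have hrange l : w l ∈ Set.range v := hwv (Set.mem_range_self l)
  simp only [clusterSet_eq_translates]
  refine ⟨eventually_all.2 fun l => ?_, fun l => ?_⟩
  · have hsep : ∀ᶠ N in atTop, ∀ m, m ≠ l →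
        2 * (h N : ℤ) ≤ |topHeight (x N) v (w m) - topHeight (x N) v (w l)| :=
      eventually_all.2 fun m => eventually_imp_distrib_left.2 fun hm =>
        eventually_topHeight_separated hv hh.tendsto_div_nhds_zero (hw.ne hm) (hrange m) (hrange l)
    filter_upwards [hsep, eventually_pos_and_two_mul_le hδ hδh (hrange l),
      eventually_translates_subset (K := K) fun i hi =>
        eventually_add_proj_mem_block_smallInterval hδ hi,
      eventually_gt_atTop 0] with N hsep ⟨hpos, hle⟩ hsub hN z₁ hz₁ z₂ hz₂
    have : NeZero N := ⟨hN.ne'⟩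
    exact excursionLaw_real_eq_mul_one_add (ζ := fun m => topHeight (x N) v (w m)) hpos hle hsep
      hsub hz₁ hz₂
  · exact tendsto_cylCap (hx.set_pairwise _)
      (fun i hi => eventually_add_proj_mem_block_bigInterval hδ hδh hi) hd
      hh.tendsto_div_nhds_zero

theorem lemma4p2 (d : ℕ) (hd : 2 ≤ d) :
    ∃ c : ℝ, 0 < c ∧
      ∀ (M : ℕ) (hM : 1 ≤ M) (K : Fin M → Finset (ZLat d))
        (x : (N : ℕ) → Fin M → Cyl d N) (v : Fin M → ℝ)
        (hx : ∀ i j, i ≠ j → Tendsto (fun N => cylDist (x N i) (x N j)) atTop atTop)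
        (hv : ∀ i, Tendsto (fun N => ((x N i).2 : ℝ) / (N : ℝ) ^ d) atTop (𝓝 (v i)))
        (L : ℕ) (w : Fin L → ℝ) (hw : StrictMono w) (hvw : Set.range v = Set.range w)
        (h δ : ℕ → ℕ)
        (hh_top : Tendsto h atTop atTop) (hδ_top : Tendsto δ atTop atTop)
        (hh_small : (fun N => (h N : ℝ)) =o[atTop] (fun N => (N : ℝ) ^ d))
        (hh_large : ∀ᶠ N : ℕ in atTop, (N : ℝ) * Real.log N ^ 2 ≤ h N)
        (hδ_small : (fun N => (δ N : ℝ)) =o[atTop] (fun N => (h N : ℝ)))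
        (hδ_large : ∀ i j, v i = v j →
          (fun N => 1 + |((x N i).2 : ℝ) - ((x N j).2 : ℝ)|) =o[atTop] (fun N => (δ N : ℝ))),
        (∀ᶠ N : ℕ in atTop, ∀ l : Fin L,
          ∀ z₁ ∈ innerBdry (smallInterval (δ N) (topHeight (x N) v (w l))),
          ∀ z₂ ∈ bdry (bigInterval (h N) (topHeight (x N) v (w l))),
            ∃ Ψ : ℝ, |Ψ| ≤ c * ((δ N : ℝ) / (h N : ℝ)) ∧
              (excursionLaw d N (δ N) (h N) (fun m => topHeight (x N) v (w m)) z₁ z₂).real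
                  {X | entranceTime (clusterSet (x N) K v (w l) : Set (Cyl d N)) X <
                    exitTime (block d N (bigInterval (h N) (topHeight (x N) v (w l)))) X} =
                ((d : ℝ) + 1) * ((h N : ℝ) / (N : ℝ) ^ d) *
                  cylCap (block d N (bigInterval (h N) (topHeight (x N) v (w l))))
                    (clusterSet (x N) K v (w l)) * (1 + Ψ)) ∧
        (∀ l : Fin L,
          Tendsto
            (fun N => cylCap (block d N (bigInterval (h N) (topHeight (x N) v (w l))))
              (clusterSet (x N) K v (w l)))
            atTop (𝓝 (∑ i ∈ cluster v (w l), latticeCap (K i)))) := by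
  exact ⟨20, by norm_num, fun _ _ K x v hx hv L w hw hvw h δ _ _ hh _ hδh hδ =>
    (lemma4p2_general hd K hx hv hw.injective hvw.ge hh hδh hδ).imp_left fun hmain =>
      hmain.mono fun N hN l z₁ hz₁ => hN l z₁ hz₁.1⟩
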